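/- Let $\mathscr C$ be a left proper cofibrantly generated model category with sets $I$ and $J$ of generating cofibrations and generating acyclic cofibrations, respectively, and assume that filtered colimits in $\mathscr C$ are homotopical, i.e. for every small filtered category $K$ the colimit of a levelwise weak equivalence of $K$-indexed diagrams in $\mathscr C$ is again a weak equivalence. Let $\mathscr D$ be a locally presentable category and let $F\colon\mathscr C\rightleftarrows\mathscr D:\!U$ be an adjunction with unit $\eta$. Consider the following conditions: (1) For each $j\in J$, the map $UFj$ is a weak equivalence. (2) For each $(i\colon A\to B)\in I$, the functor $U$ sends every pushout square in $\mathscr D$ of the form $$\begin{array}{ccc} FA & \xrightarrow{Fi} & FB\\ \downarrow & & \downarrow\\ X & \to & Y\end{array}$$ to a homotopy pushout in $\mathscr C$. (3) For each small filtered poset $P$ and each diagram $X_\bullet\colon P\to\mathscr D$ the natural comparison map $\operatorname{colim}_P(U\circ X_\bullet)\to U(\operatorname{colim}_P X_\bullet)$ is a weak equivalence. (1$'$) $J$ consists of maps between cofibrant objects, $\eta_\varnothing$ is a weak equivalence (where $\varnothing$ is the initial object of $\mathscr C$), and $\eta_X$ and $\eta_Y$ are weak equivalences for each map $(X\to Y)\in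 I$. Here a commutative square $A\xrightarrow{f}B$, $A\xrightarrow{g}X$, $B\xrightarrow{h}Y$, $X\xrightarrow{k}Y$ ($hf=kg$) in a left proper model category is a homotopy pushout if for some (equivalently, any) factorization of $f$ into a cofibration $A\to B'$ followed by a weak equivalence $B'\to B$ the induced map $X\sqcup_A B'\to Y$ is a weak equivalence; homotopy pullbacks in right proper model categories are defined dually. We say that $U$ creates homotopy pushouts (pullbacks) if a commutative square in $\mathscr D$ is a homotopy pushout (pullback) if and only if its image under $U$ is. Assume (2) and (3). Then: (a) If (1) holds, there exists a unique model structure on $\mathscr D$ in which a map $f$ is a weak equivalence or fibration if and only if $Uf$ is a weak equivalence or fibration, respectively, in $\mathscr C$ (the transferred model structure). It is combinatorial, with set of generating cofibrations $FI=\{Fi: i\in I\}$ and set of generating acyclic cofibrations $FJ=\{Fj: j\in J\}$; it is left proper, $U$ creates homotopy pushouts, and filtered colimits in $\mathscr D$ are homotopical. If $\mathscr C$ is moreover right proper, then so is $\mathscr D$, and $U$ also creates homotopy pullbacks. (b) If (1$'$) holds, then (1) holds, and the adjunction $F\dashv U$ is a Quillen equivalence with respect to the given model structure on $\mathscr C$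 and the transferred model structure on $\mathscr D$. -/

import Mathlib

open CategoryTheory Limits HomotopicalAlgebra

universe w u u'

namespace TransferCriterion

section ModelCategoryNotions

variable {C : Type u} [Category.{w} C]

/-- The sets `I` and `J` are generating cofibrations and generating acyclic cofibrations of the
model category `C`: both permit the small object argument (in particular they are small),
the fibrations are the maps with the right lifting property against `J`, and the acyclic
fibrations are the maps with the right lifting property against `I`. -/
structure IsCofibrantlyGenerated [ModelCategory C] (I J : MorphismProperty C) : Prop where
  smallObjectArgument_I : MorphismProperty.HasSmallObjectArgument.{w} I
  smallObjectArgument_J : MorphismProperty.HasSmallObjectArgument.{w} J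
  fibrations_eq : fibrations C = J.rlp
  trivialFibrations_eq : trivialFibrations C = I.rlp

/-- A combinatorial model category with generating cofibrations `I` and generating acyclic
cofibrations `J`: a cofibrantly generated one whose underlying category is locally presentable. -/
structure IsCombinatorial [ModelCategory C] (I J : MorphismProperty C) : Prop extends
    IsCofibrantlyGenerated I J where
  locallyPresentable : IsLocallyPresentable.{w} C

variable (C) in
/-- Filtered colimits are homotopical: for every small filtered category `K`, the colimit of a
levelwise weak equivalence of diagrams of shape `K` is a weak equivalence. -/
def FilteredColimitsHomotopical [ModelCategory C] : Prop :=
  MorphismProperty.IsStableUnderFilteredColimits.{w, w} (weakEquivalences C)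

variable (C) in
/-- Left properness: weak equivalences are stable under pushout along cofibrations. -/
def IsLeftProper [ModelCategory C] : Prop :=
  ∀ ⦃A B A' B' : C⦄ (f : A ⟶ B) (i : A ⟶ A') (i' : B ⟶ B') (f' : A' ⟶ B'),
    IsPushout f i i' f' → Cofibration i → WeakEquivalence f → WeakEquivalence f'

variable (C) in
/-- Right properness: weak equivalences are stable under pullback along fibrations. -/
def IsRightProper [ModelCategory C] : Prop :=
  ∀ ⦃A B A' B' : C⦄ (f' : A' ⟶ B') (p' : A' ⟶ A) (p : B' ⟶ B) (f : A ⟶ B),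
    IsPullback f' p' p f → Fibration p → WeakEquivalence f → WeakEquivalence f'

/-- The commutative square
```
A --f--> B
|g       |h
v        v
X --k--> Y
```
in a (left proper) model category is a homotopy pushout: for some factorization of `f` into a
cofibration `i : A ⟶ B'` followed by a weak equivalence `p : B' ⟶ B`, the induced map
`q : X ⊔_A B' ⟶ Y` is a weak equivalence. -/
def IsHomotopyPushout [ModelCategory C] {A B X Y : C}
    (f : A ⟶ B) (g : A ⟶ X) (h : B ⟶ Y) (k : X ⟶ Y) : Prop :=
  CommSq f g h k ∧
    ∃ (B' P : C) (i : A ⟶ B') (p : B' ⟶ B) (inl : B' ⟶ P) (inr : X ⟶ P) (q : P ⟶ Y),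
      Cofibration i ∧ WeakEquivalence p ∧ i ≫ p = f ∧ IsPushout i g inl inr ∧
        inl ≫ q = p ≫ h ∧ inr ≫ q = k ∧ WeakEquivalence q

/-- The commutative square
```
A --f--> B
|g       |h
v        v
X --k--> Y
```
in a (right proper) model category is a homotopy pullback: for some factorization of `h` into a
weak equivalence `j : B ⟶ B'` followed by a fibration `p : B' ⟶ Y`, the induced map
`q : A ⟶ X ×_Y B'` is a weak equivalence. -/
def IsHomotopyPullback [ModelCategory C] {A B X Y : C}
    (f : A ⟶ B) (g : A ⟶ X) (h : B ⟶ Y) (k : X ⟶ Y) : Prop :=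
  CommSq f g h k ∧
    ∃ (B' P : C) (j : B ⟶ B') (p : B' ⟶ Y) (fst : P ⟶ B') (snd : P ⟶ X) (q : A ⟶ P),
      WeakEquivalence j ∧ Fibration p ∧ j ≫ p = h ∧ IsPullback fst snd p k ∧
        q ≫ fst = f ≫ j ∧ q ≫ snd = g ∧ WeakEquivalence q

end ModelCategoryNotions

section FunctorNotions

variable {C : Type u} [Category.{w} C] {D : Type u'} [Category.{w} D]

/-- `M` is the model structure on `D` transferred along an adjunction with right adjoint `U`:
a map is a weak equivalence or fibration iff its image under `U` is one. -/
def IsTransferred [ModelCategory C] (U : D ⥤ C) (M : ModelCategory D) : Prop :=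
  weakEquivalences D = (weakEquivalences C).inverseImage U ∧
    fibrations D = (fibrations C).inverseImage U

/-- `U` creates homotopy pushouts: a commutative square is a homotopy pushout
iff its image under `U` is. -/
def CreatesHomotopyPushouts [ModelCategory C] [ModelCategory D] (U : D ⥤ C) : Prop :=
  ∀ ⦃A B X Y : D⦄ (f : A ⟶ B) (g : A ⟶ X) (h : B ⟶ Y) (k : X ⟶ Y), CommSq f g h k →
    (IsHomotopyPushout f g h k ↔ IsHomotopyPushout (U.map f) (U.map g) (U.map h) (U.map k))

/-- `U` creates homotopy pullbacks: a commutative square is a homotopy pullback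
iff its image under `U` is. -/
def CreatesHomotopyPullbacks [ModelCategory C] [ModelCategory D] (U : D ⥤ C) : Prop :=
  ∀ ⦃A B X Y : D⦄ (f : A ⟶ B) (g : A ⟶ X) (h : B ⟶ Y) (k : X ⟶ Y), CommSq f g h k →
    (IsHomotopyPullback f g h k ↔ IsHomotopyPullback (U.map f) (U.map g) (U.map h) (U.map k))

/-- `U` preserves colimits indexed by small filtered posets up to weak equivalence: the comparison
map `colim (U ∘ X) ⟶ U (colim X)` is a weak equivalence. -/
def PreservesFilteredColimitsUpToWeakEquivalence [ModelCategory C] [HasColimitsOfSize.{w, w} C]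
    (U : D ⥤ C) : Prop :=
  ∀ (P : Type w) [PartialOrder P] [IsFiltered P] (X : P ⥤ D) (c : Cocone X), IsColimit c →
    WeakEquivalence (colimit.desc (X ⋙ U) (U.mapCocone c))

/-- A Quillen adjunction: the left adjoint preserves cofibrations and acyclic cofibrations. -/
structure IsQuillenAdjunction [ModelCategory C] [ModelCategory D] {F : C ⥤ D} {U : D ⥤ C}
    (_ : F ⊣ U) : Prop where
  map_cofibration : ∀ ⦃A B : C⦄ (i : A ⟶ B), Cofibration i → Cofibration (F.map i)
  map_trivialCofibration : ∀ ⦃A B : C⦄ (i : A ⟶ B), Cofibration i → WeakEquivalence i →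
    WeakEquivalence (F.map i)

/-- A Quillen equivalence: for cofibrant `X` and fibrant `Y`, a map `F X ⟶ Y` is a weak
equivalence iff its adjunct `X ⟶ U Y` is. -/
structure IsQuillenEquivalence [ModelCategory C] [ModelCategory D] {F : C ⥤ D} {U : D ⥤ C}
    (adj : F ⊣ U) : Prop extends IsQuillenAdjunction adj where
  weakEquivalence_iff : ∀ (X : C) (Y : D), IsCofibrant X → IsFibrant Y → ∀ f : F.obj X ⟶ Y,
    WeakEquivalence f ↔ WeakEquivalence (adj.homEquiv X Y f)

/-- `J` consists of maps between cofibrant objects, and the unit of the adjunction is a weak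
equivalence on the initial object and on the sources and targets of the maps in `I`. -/
structure UnitCondition [ModelCategory C] {F : C ⥤ D} {U : D ⥤ C} (adj : F ⊣ U)
    (I J : MorphismProperty C) : Prop where
  cofibrant : ∀ ⦃A B : C⦄ (j : A ⟶ B), J j → IsCofibrant A ∧ IsCofibrant B
  unit_initial : WeakEquivalence (adj.unit.app (⊥_ C))
  unit_generators : ∀ ⦃A B : C⦄ (i : A ⟶ B), I i →
    WeakEquivalence (adj.unit.app A) ∧ WeakEquivalence (adj.unit.app B)

end FunctorNotions

end TransferCriterion

open TransferCriterion

/-! Call a map of `D` homotopy flat if `U` turns all its pushouts into homotopy pushouts; `hpush`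
says that `F I` consists of such maps. Pasting of homotopy pushouts makes this class closed under
cobase change, composition and retracts; `hcolim` and homotopical filtered colimits in `C` make it
closed under colimits of arrows over filtered posets. Coproducts and transfinite compositions reduce
to these operations, so all maps in `(I.strictMap F).rlp.llp`, the future cofibrations, are homotopy
flat (`llp_rlp_strictMap_le_homotopyFlatMorphisms`). The homotopy flat maps inverted up to homotopy
by `U` have the same closure properties. This yields the acyclicity condition of Kan's transfer
argument (`llp_rlp_strictMap_le_weakEquivalences`), while smallness is automatic in a locally
presentable category. Left properness and creation of homotopy pushouts then follow from homotopy
flatness of cofibrations, and the dual statements from the fact that `U` preserves pullbacks.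

Filtered colimits of cofibrations need not be cofibrations. Homotopy pushouts in `C` are therefore
computed with the larger class `flatMorphisms`, which is closed under filtered colimits.

For the Quillen equivalence, a similar cell argument in `C` shows that the unit is a weak
equivalence on cofibrant objects (`weakEquivalence_unit_of_isCofibrant`). Two-out-of-three then
gives the condition on `J`, and the adjunct of `f : F X ⟶ Y` is the unit at `X` followed by `U f`.
-/

namespace TransferCriterion

/-! ### Homotopy pushouts in a left proper model category -/

section HomotopyPushouts

variable {C : Type u} [Category.{w} C] [ModelCategory C]

lemma exists_cofibration_fac {A B : C} (f : A ⟶ B) :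
    ∃ (Z : C) (i : A ⟶ Z) (p : Z ⟶ B),
      Cofibration i ∧ Fibration p ∧ WeakEquivalence p ∧ i ≫ p = f := by
  let h := MorphismProperty.factorizationData (cofibrations C) (trivialFibrations C) f
  exact ⟨h.Z, h.i, h.p, inferInstance, inferInstance, inferInstance, h.fac⟩

lemma exists_trivialCofibration_fac {A B : C} (f : A ⟶ B) :
    ∃ (Z : C) (i : A ⟶ Z) (p : Z ⟶ B),
      Cofibration i ∧ WeakEquivalence i ∧ Fibration p ∧ i ≫ p = f := by
  let h := MorphismProperty.factorizationData (trivialCofibrations C) (fibrations C) f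
  exact ⟨h.Z, h.i, h.p, inferInstance, inferInstance, inferInstance, h.fac⟩

lemma cofibration_of_isPushout {A B X Y : C} {f : A ⟶ B} {g : A ⟶ X} {h : B ⟶ Y} {k : X ⟶ Y}
    (sq : IsPushout f g h k) (hf : Cofibration f) : Cofibration k := by
  rw [cofibration_iff] at hf ⊢
  exact MorphismProperty.of_isPushout sq.flip hf

variable (C) in
/-- A morphism is flat if pushing out along any of its cobase changes
preserves weak equivalences. -/
def flatMorphisms : MorphismProperty C := fun A B i ↦
  ∀ ⦃X P X' P' : C⦄ (g : A ⟶ X) (inl : B ⟶ P) (j : X ⟶ P) (w : X ⟶ X') (w' : P ⟶ P')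
    (j' : X' ⟶ P'), IsPushout i g inl j → IsPushout j w w' j' → WeakEquivalence w →
      WeakEquivalence w'

lemma flatMorphisms_of_cofibration (hC : IsLeftProper C) {A B : C} (i : A ⟶ B)
    (hi : Cofibration i) : flatMorphisms C i :=
  fun _ _ _ _ _ _ j w w' j' hj hj' hw ↦
    hC w j j' w' hj'.flip (cofibration_of_isPushout hj hi) hw

lemma flatMorphisms_id (A : C) : flatMorphisms C (𝟙 A) := by
  intro X P X' P' g inl j w w' j' hj hj' hw
  have : IsIso j := hj.isIso_inr_of_isIso
  have : IsIso j' := hj'.isIso_inr_of_isIso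
  have h : j ≫ w' = w ≫ j' := hj'.w
  have : WeakEquivalence (j ≫ w') := by rw [h]; infer_instance
  exact weakEquivalence_of_precomp j w'

lemma flatMorphisms.weakEquivalence_desc {A B X X' P P' : C} {i : A ⟶ B} (hi : flatMorphisms C i)
    {g : A ⟶ X} {inl : B ⟶ P} {inr : X ⟶ P} (hP : IsPushout i g inl inr)
    {w : X ⟶ X'} (hw : WeakEquivalence w) {g' : A ⟶ X'} (hg' : g ≫ w = g')
    {inl' : B ⟶ P'} {inr' : X' ⟶ P'}
    (hP' : IsPushout i g' inl' inr') (v : P ⟶ P') (h₁ : inl ≫ v = inl')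
    (h₂ : inr ≫ v = w ≫ inr') : WeakEquivalence v := by
  subst hg' h₁
  exact hi _ _ _ _ _ _ hP (hP'.of_top h₂ hP) hw

/-- Pushouts along flat morphisms are invariant under weak equivalences between
the targets of the flat morphisms. -/
lemma flatMorphisms.weakEquivalence_desc_of_comp (hC : IsLeftProper C)
    {A B₁ B₂ X P₁ P₂ : C} {i₁ : A ⟶ B₁} {i₂ : A ⟶ B₂}
    (h₁ : flatMorphisms C i₁) (h₂ : flatMorphisms C i₂) {u : B₁ ⟶ B₂} (hu : WeakEquivalence u)
    (hi : i₁ ≫ u = i₂) {g : A ⟶ X} {inl₁ : B₁ ⟶ P₁} {inr₁ : X ⟶ P₁}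
    (hP₁ : IsPushout i₁ g inl₁ inr₁) {inl₂ : B₂ ⟶ P₂} {inr₂ : X ⟶ P₂}
    (hP₂ : IsPushout i₂ g inl₂ inr₂) (v : P₁ ⟶ P₂) (hv₁ : inl₁ ≫ v = u ≫ inl₂)
    (hv₂ : inr₁ ≫ v = inr₂) : WeakEquivalence v := by
  -- Left properness applies once `g` is replaced by a cofibration `c`, since `u` is then pushed out
  -- along a cofibration. Flatness of `i₁` and `i₂` transports the result back along `w`.
  obtain ⟨X', c, w, hc, -, hw, rfl⟩ := exists_cofibration_fac g
  have sq₁ := IsPushout.of_hasPushout i₁ c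
  have sq := IsPushout.of_hasPushout u (pushout.inl i₁ c)
  have sq₂ := sq₁.paste_horiz sq
  rw [hi] at sq₂
  let a₁ : pushout i₁ c ⟶ P₁ := sq₁.desc inl₁ (w ≫ inr₁) (by simpa using hP₁.w)
  let a₂ : pushout u (pushout.inl i₁ c) ⟶ P₂ := sq₂.desc inl₂ (w ≫ inr₂) (by simpa using hP₂.w)
  have ha₁ : WeakEquivalence a₁ :=
    h₁.weakEquivalence_desc sq₁ hw rfl hP₁ a₁ (by simp [a₁]) (by simp [a₁])
  have ha₂ : WeakEquivalence a₂ :=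
    h₂.weakEquivalence_desc sq₂ hw rfl hP₂ a₂ (sq₂.inl_desc _ _ _) (sq₂.inr_desc _ _ _)
  have hv : WeakEquivalence (pushout.inr u (pushout.inl i₁ c)) :=
    hC _ _ _ _ sq (cofibration_of_isPushout sq₁.flip hc) hu
  have fac : a₁ ≫ v = pushout.inr u (pushout.inl i₁ c) ≫ a₂ := by
    apply sq₁.hom_ext
    · have h := sq₂.inl_desc inl₂ (w ≫ inr₂) (by simpa using hP₂.w)
      rw [← Category.assoc, sq₁.inl_desc, hv₁, ← Category.assoc, ← sq.w, Category.assoc]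
      exact congr_arg (u ≫ ·) h.symm
    · have h := sq₂.inr_desc inl₂ (w ≫ inr₂) (by simpa using hP₂.w)
      rw [← Category.assoc, sq₁.inr_desc, Category.assoc, hv₂, ← Category.assoc]
      exact h.symm
  have : WeakEquivalence (a₁ ≫ v) := by rw [fac]; infer_instance
  exact weakEquivalence_of_precomp a₁ v

/-- Homotopy pushouts can be tested using any factorization into a flat morphism
followed by a weak equivalence. -/
lemma isHomotopyPushout_iff_of_flatMorphisms (hC : IsLeftProper C) {A B X Y : C}
    {f : A ⟶ B} {g : A ⟶ X} {h : B ⟶ Y} {k : X ⟶ Y} (sq : CommSq f g h k)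
    {B' P : C} {i : A ⟶ B'} {p : B' ⟶ B} {inl : B' ⟶ P} {inr : X ⟶ P} {q : P ⟶ Y}
    (hi : flatMorphisms C i) (hp : WeakEquivalence p) (fac : i ≫ p = f)
    (hP : IsPushout i g inl inr) (hq₁ : inl ≫ q = p ≫ h) (hq₂ : inr ≫ q = k) :
    IsHomotopyPushout f g h k ↔ WeakEquivalence q := by
  -- comparison of two factorizations related by a map of the intermediate objects
  have key : ∀ {B₁ P₁ B₂ P₂ : C} {i₁ : A ⟶ B₁} {p₁ : B₁ ⟶ B} {inl₁ : B₁ ⟶ P₁} {inr₁ : X ⟶ P₁}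
      {q₁ : P₁ ⟶ Y} {i₂ : A ⟶ B₂} {p₂ : B₂ ⟶ B} {inl₂ : B₂ ⟶ P₂} {inr₂ : X ⟶ P₂}
      {q₂ : P₂ ⟶ Y} (u : B₁ ⟶ B₂), flatMorphisms C i₁ → flatMorphisms C i₂ →
      WeakEquivalence p₁ → WeakEquivalence p₂ → i₁ ≫ u = i₂ → u ≫ p₂ = p₁ →
      IsPushout i₁ g inl₁ inr₁ → IsPushout i₂ g inl₂ inr₂ →
      inl₁ ≫ q₁ = p₁ ≫ h → inr₁ ≫ q₁ = k → inl₂ ≫ q₂ = p₂ ≫ h → inr₂ ≫ q₂ = k →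
      (WeakEquivalence q₁ ↔ WeakEquivalence q₂) := by
    intro B₁ P₁ B₂ P₂ i₁ p₁ inl₁ inr₁ q₁ i₂ p₂ inl₂ inr₂ q₂ u h₁ h₂ hp₁ hp₂ hu hu' hP₁ hP₂
      e₁ e₂ e₃ e₄
    have : WeakEquivalence u := weakEquivalence_of_postcomp_of_fac hu'
    let v : P₁ ⟶ P₂ := hP₁.desc (u ≫ inl₂) inr₂ (by rw [← Category.assoc, hu, hP₂.w])
    have hv : WeakEquivalence v := h₁.weakEquivalence_desc_of_comp hC h₂ this hu hP₁ hP₂ v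
      (hP₁.inl_desc _ _ _) (hP₁.inr_desc _ _ _)
    have : v ≫ q₂ = q₁ := by
      apply hP₁.hom_ext
      · simp [v, e₃, e₁, ← hu']
      · simp [v, e₄, e₂]
    rw [← this, weakEquivalence_precomp_iff]
  obtain ⟨B₀, i₀, p₀, hi₀, hp₀, hp₀', fac₀⟩ := exists_cofibration_fac f
  have hP₀ := IsPushout.of_hasPushout i₀ g
  let q₀ : pushout i₀ g ⟶ Y := hP₀.desc (p₀ ≫ h) k (by rw [← Category.assoc, fac₀, sq.w])
  -- any factorization into a flat morphism and a weak equivalence is compared to the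
  -- factorization through `B₀`
  have main : ∀ {B' P : C} {i : A ⟶ B'} {p : B' ⟶ B} {inl : B' ⟶ P} {inr : X ⟶ P} {q : P ⟶ Y},
      flatMorphisms C i → WeakEquivalence p → i ≫ p = f → IsPushout i g inl inr →
      inl ≫ q = p ≫ h → inr ≫ q = k → (WeakEquivalence q ↔ WeakEquivalence q₀) := by
    intro B' P i p inl inr q hi hp fac hP hq₁ hq₂
    -- A flat `i` need not lift against `p₀`, but the cofibration `i₁` does. Hence `B₁` maps to both
    -- `B'` and `B₀`, and `key` applies twice.
    obtain ⟨B₁, i₁, r, hi₁, _, hr, fac₁⟩ := exists_cofibration_fac i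
    have hP₁ := IsPushout.of_hasPushout i₁ g
    have sq₁ : CommSq i₀ i₁ p₀ (r ≫ p) := ⟨by rw [← Category.assoc, fac₁, fac, fac₀]⟩
    let q₁ : pushout i₁ g ⟶ Y := hP₁.desc (r ≫ p ≫ h) k (by
      rw [← Category.assoc, ← Category.assoc, fac₁, fac, sq.w])
    have hi₁' := flatMorphisms_of_cofibration hC i₁ hi₁
    have e₁ : WeakEquivalence q₁ ↔ WeakEquivalence q :=
      key r hi₁' hi inferInstance hp fac₁ rfl hP₁ hP
        (by simp [q₁]) (by simp [q₁]) hq₁ hq₂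
    have e₂ : WeakEquivalence q₁ ↔ WeakEquivalence q₀ :=
      key sq₁.lift hi₁' (flatMorphisms_of_cofibration hC i₀ hi₀) inferInstance hp₀'
        (sq₁.fac_left) (sq₁.fac_right) hP₁ hP₀
        (by simp [q₁]) (by simp [q₁]) (by simp [q₀]) (by simp [q₀])
    exact e₁.symm.trans e₂
  rw [main hi hp fac hP hq₁ hq₂]
  constructor
  · rintro ⟨-, B₁, P₁, i₁, p₁, inl₁, inr₁, q₁, hi₁, hp₁, fac₁, hP₁, e₁, e₂, hq⟩
    exact (main (flatMorphisms_of_cofibration hC i₁ hi₁) hp₁ fac₁ hP₁ e₁ e₂).1 hq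
  · intro hq
    exact ⟨sq, B₀, _, i₀, p₀, _, _, q₀, hi₀, hp₀', fac₀, hP₀, by simp [q₀], by simp [q₀], hq⟩

lemma isHomotopyPushout_of_isPushout (hC : IsLeftProper C) {A B X Y : C}
    {f : A ⟶ B} {g : A ⟶ X} {h : B ⟶ Y} {k : X ⟶ Y} (sq : IsPushout f g h k)
    (hf : flatMorphisms C f) : IsHomotopyPushout f g h k :=
  (isHomotopyPushout_iff_of_flatMorphisms hC sq.toCommSq hf (p := 𝟙 B) inferInstance
    (Category.comp_id _) sq (q := 𝟙 Y) (by simp) (by simp)).2 inferInstance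

/-- Factoring `f` as `𝟙 A` followed by `f` is allowed because identities are flat; the pushout is
then `X` and the comparison map is `k`. -/
lemma isHomotopyPushout_iff_of_weakEquivalence_top (hC : IsLeftProper C) {A B X Y : C}
    {f : A ⟶ B} {g : A ⟶ X} {h : B ⟶ Y} {k : X ⟶ Y} (sq : CommSq f g h k)
    (hf : WeakEquivalence f) : IsHomotopyPushout f g h k ↔ WeakEquivalence k :=
  isHomotopyPushout_iff_of_flatMorphisms hC sq (flatMorphisms_id A) hf (Category.id_comp _)
    (IsPushout.of_horiz_isIso (f := 𝟙 A) (g := g) (inl := g) (inr := 𝟙 X) ⟨by simp⟩)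
    sq.w.symm (Category.id_comp _)

/-- Replacing both legs by cofibrations gives a pushout with weak equivalences, compatible over `Y`,
to both one-sided replacements. -/
lemma IsHomotopyPushout.flip (hC : IsLeftProper C) {A B X Y : C}
    {f : A ⟶ B} {g : A ⟶ X} {h : B ⟶ Y} {k : X ⟶ Y} (sq : IsHomotopyPushout f g h k) :
    IsHomotopyPushout g f k h := by
  obtain ⟨sq, B', P, i, p, inl, inr, q, hi, hp, fac, hP, hq₁, hq₂, hq⟩ := sq
  obtain ⟨X', c, r, hc, _, hr, facr⟩ := exists_cofibration_fac g
  have hP' := IsPushout.of_hasPushout i c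
  have hQ := IsPushout.of_hasPushout c f
  let a : pushout i c ⟶ P := hP'.desc inl (r ≫ inr) (by rw [← Category.assoc, facr, hP.w])
  let b : pushout i c ⟶ pushout c f := hP'.desc (p ≫ pushout.inr c f) (pushout.inl c f) (by
    rw [← Category.assoc, fac, hQ.w])
  let q' : pushout c f ⟶ Y := hQ.desc (r ≫ k) h (by rw [← Category.assoc, facr, sq.w])
  have ha : WeakEquivalence a := (flatMorphisms_of_cofibration hC i hi).weakEquivalence_desc
    hP' hr facr hP a (by simp [a]) (by simp [a])
  have hb : WeakEquivalence b := (flatMorphisms_of_cofibration hC c hc).weakEquivalence_desc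
    hP'.flip hp fac hQ b (by simp [b]) (by simp [b])
  have : b ≫ q' = a ≫ q := by
    apply hP'.hom_ext
    · simp [b, q', a, hq₁]
    · simp [b, q', a, hq₂]
  have : WeakEquivalence (b ≫ q') := by rw [this]; infer_instance
  exact ⟨sq.flip, X', _, c, r, _, _, q', hc, hr, facr, hQ, by simp [q'], by simp [q'],
    weakEquivalence_of_precomp b q'⟩

lemma isHomotopyPushout_iff_of_weakEquivalence_left (hC : IsLeftProper C) {A B X Y : C}
    {f : A ⟶ B} {g : A ⟶ X} {h : B ⟶ Y} {k : X ⟶ Y} (sq : CommSq f g h k)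
    (hg : WeakEquivalence g) : IsHomotopyPushout f g h k ↔ WeakEquivalence h := by
  rw [← isHomotopyPushout_iff_of_weakEquivalence_top hC sq.flip hg]
  exact ⟨fun h ↦ h.flip hC, fun h ↦ h.flip hC⟩

/-- Vertical pasting of homotopy pushouts. -/
lemma IsHomotopyPushout.paste_vert_iff (hC : IsLeftProper C) {A B X Y X' Y' : C}
    {f : A ⟶ B} {g : A ⟶ X} {h : B ⟶ Y} {k : X ⟶ Y} (sq : IsHomotopyPushout f g h k)
    {g' : X ⟶ X'} {h' : Y ⟶ Y'} {k' : X' ⟶ Y'} (sq' : CommSq k g' h' k') :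
    IsHomotopyPushout f (g ≫ g') (h ≫ h') k' ↔ IsHomotopyPushout k g' h' k' := by
  obtain ⟨sq, B', P, i, p, inl, inr, q, hi, hp, fac, hP, hq₁, hq₂, hq⟩ := sq
  have hP' := IsPushout.of_hasPushout inr g'
  have hi' := cofibration_of_isPushout hP hi
  let r : pushout inr g' ⟶ Y' := hP'.desc (q ≫ h') k' (by rw [← Category.assoc, hq₂, sq'.w])
  rw [isHomotopyPushout_iff_of_flatMorphisms hC sq' (flatMorphisms_of_cofibration hC inr hi') hq
    hq₂ hP' (q := r) (by simp [r]) (by simp [r]),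
    isHomotopyPushout_iff_of_flatMorphisms hC (sq.vert_comp sq')
      (flatMorphisms_of_cofibration hC i hi) hp fac (hP.paste_vert hP') (q := r)
      (by simp only [Category.assoc, r, hP'.inl_desc, reassoc_of% hq₁]) (by simp [r])]

/-- Horizontal pasting of homotopy pushouts. -/
lemma IsHomotopyPushout.paste_horiz_iff (hC : IsLeftProper C) {A B X Y B' Y' : C}
    {f : A ⟶ B} {g : A ⟶ X} {h : B ⟶ Y} {k : X ⟶ Y} (sq : IsHomotopyPushout f g h k)
    {f' : B ⟶ B'} {h' : B' ⟶ Y'} {k' : Y ⟶ Y'} (sq' : CommSq f' h h' k') :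
    IsHomotopyPushout (f ≫ f') g h' (k ≫ k') ↔ IsHomotopyPushout f' h h' k' := by
  have := (sq.flip hC).paste_vert_iff hC sq'.flip
  constructor
  · intro h
    exact (this.1 (h.flip hC)).flip hC
  · intro h
    exact (this.2 (h.flip hC)).flip hC

/-- Homotopy pushouts are invariant under weak equivalences of the lower edge. -/
lemma isHomotopyPushout_iff_of_weakEquivalence_bottom (hC : IsLeftProper C) {A B X Y X' Y' : C}
    {f : A ⟶ B} {g : A ⟶ X} {h : B ⟶ Y} {k : X ⟶ Y} (sq : CommSq f g h k)
    {g' : X ⟶ X'} {h' : Y ⟶ Y'} {k' : X' ⟶ Y'} (sq' : CommSq k g' h' k')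
    (hg' : WeakEquivalence g') (hh' : WeakEquivalence h') :
    IsHomotopyPushout f (g ≫ g') (h ≫ h') k' ↔ IsHomotopyPushout f g h k := by
  obtain ⟨B', i, p, hi, _, hp, fac⟩ := exists_cofibration_fac f
  have hi' := flatMorphisms_of_cofibration hC i hi
  have hP := IsPushout.of_hasPushout i g
  have hQ := IsPushout.of_hasPushout (pushout.inr i g) g'
  let q : pushout i g ⟶ Y := hP.desc (p ≫ h) k (by rw [← Category.assoc, fac, sq.w])
  let r : pushout (pushout.inr i g) g' ⟶ Y' := hQ.desc (q ≫ h') k' (by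
    simp [q, sq'.w])
  have hv : WeakEquivalence (pushout.inl (pushout.inr i g) g') :=
    hi' _ _ _ _ _ _ hP hQ hg'
  rw [isHomotopyPushout_iff_of_flatMorphisms hC sq hi' hp fac hP (q := q)
      (by simp [q]) (by simp [q]),
    isHomotopyPushout_iff_of_flatMorphisms hC (sq.vert_comp sq') hi' hp fac (hP.paste_vert hQ)
      (q := r) (by simp [r, q]) (by simp [r])]
  have : pushout.inl (pushout.inr i g) g' ≫ r = q ≫ h' := by simp [r]
  rw [← weakEquivalence_precomp_iff (pushout.inl (pushout.inr i g) g') r, this,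
    weakEquivalence_postcomp_iff]

section Cube

variable {A B X Y A' B' X' Y' : C} {f' : A' ⟶ B'} {g' : A' ⟶ X'} {h' : B' ⟶ Y'} {k' : X' ⟶ Y'}
  {a : A ⟶ A'} {b : B ⟶ B'} {x : X ⟶ X'} {y : Y ⟶ Y'}
  {f : A ⟶ B} {g : A ⟶ X} {h : B ⟶ Y} {k : X ⟶ Y}

/-- Homotopy pushouts are invariant under weak equivalences of squares. -/
lemma isHomotopyPushout_iff_of_weakEquivalences (hC : IsLeftProper C)
    (sq : CommSq f g h k) (sq₂ : CommSq f' g' h' k')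
    (hf : f ≫ b = a ≫ f') (hg : g ≫ x = a ≫ g') (hh : h ≫ y = b ≫ h') (hk : k ≫ y = x ≫ k')
    (ha : WeakEquivalence a) (hb : WeakEquivalence b) (hx : WeakEquivalence x)
    (hy : WeakEquivalence y) :
    IsHomotopyPushout f g h k ↔ IsHomotopyPushout f' g' h' k' := by
  have h₁ : IsHomotopyPushout f a b f' :=
    (isHomotopyPushout_iff_of_weakEquivalence_left hC ⟨hf⟩ ha).2 hb
  rw [← isHomotopyPushout_iff_of_weakEquivalence_bottom hC sq ⟨hk⟩ hx hy, hg, hh,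
    h₁.paste_vert_iff hC sq₂]

/-- A map of homotopy pushouts is a weak equivalence if its three other components are. -/
lemma IsHomotopyPushout.weakEquivalence (hC : IsLeftProper C)
    (sq : IsHomotopyPushout f g h k) (sq' : IsHomotopyPushout f' g' h' k')
    (hf : f ≫ b = a ≫ f') (hg : g ≫ x = a ≫ g') (hh : h ≫ y = b ≫ h') (hk : k ≫ y = x ≫ k')
    (ha : WeakEquivalence a) (hb : WeakEquivalence b) (hx : WeakEquivalence x) :
    WeakEquivalence y := by
  have h₁ : IsHomotopyPushout f a b f' :=
    (isHomotopyPushout_iff_of_weakEquivalence_left hC ⟨hf⟩ ha).2 hb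
  have h₂ := (h₁.paste_vert_iff hC sq'.1).2 sq'
  rw [← hg, ← hh, sq.paste_vert_iff hC ⟨hk⟩] at h₂
  exact (isHomotopyPushout_iff_of_weakEquivalence_left hC ⟨hk⟩ hx).1 h₂

end Cube

/-- Homotopy pushouts along a fixed morphism `g` are stable under retracts. -/
lemma IsHomotopyPushout.of_retract (hC : IsLeftProper C) {A B X Y B' Y' : C}
    {f : A ⟶ B} {g : A ⟶ X} {h : B ⟶ Y} {k : X ⟶ Y} {f' : A ⟶ B'} {h' : B' ⟶ Y'} {k' : X ⟶ Y'}
    (sq' : IsHomotopyPushout f' g h' k') (sq : CommSq f g h k)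
    {s : B ⟶ B'} {r : B' ⟶ B} (hsr : s ≫ r = 𝟙 B) (hs : f ≫ s = f') (hr : f' ≫ r = f)
    {s' : Y ⟶ Y'} {r' : Y' ⟶ Y} (hsr' : s' ≫ r' = 𝟙 Y) (hs' : k ≫ s' = k') (hr' : k' ≫ r' = k)
    (hh : h ≫ s' = s ≫ h') (hh' : h' ≫ r' = r ≫ h) : IsHomotopyPushout f g h k := by
  -- The leg `g` is common to both squares, so one factorization of it serves both, and the
  -- comparison map `q` becomes a retract of `q'`.
  obtain ⟨X', c, p, hc, _, hp, fac⟩ := exists_cofibration_fac g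
  have hc' := flatMorphisms_of_cofibration hC c hc
  have hP := IsPushout.of_hasPushout c f
  have hP' := IsPushout.of_hasPushout c f'
  let q : pushout c f ⟶ Y := hP.desc (p ≫ k) h (by rw [← Category.assoc, fac, sq.w])
  let q' : pushout c f' ⟶ Y' := hP'.desc (p ≫ k') h' (by rw [← Category.assoc, fac, sq'.1.w])
  have hq' : WeakEquivalence q' :=
    (isHomotopyPushout_iff_of_flatMorphisms hC sq'.1.flip hc' hp fac hP' (q := q')
      (by simp [q']) (by simp [q'])).1 (sq'.flip hC)
  refine IsHomotopyPushout.flip hC ((isHomotopyPushout_iff_of_flatMorphisms hC sq.flip hc' hp fac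
    hP (q := q) (by simp [q]) (by simp [q])).2 ?_)
  rw [weakEquivalence_iff] at hq' ⊢
  refine MorphismProperty.of_retract (P := weakEquivalences C) (f := q) (g := q') ?_ hq'
  exact
    { i := Arrow.homMk (hP.desc (pushout.inl c f') (s ≫ pushout.inr c f')
        (by rw [reassoc_of% hs, hP'.w])) s' (by
          apply hP.hom_ext
          · simp [q, q', hs']
          · simp [q, q', hh])
      r := Arrow.homMk (hP'.desc (pushout.inl c f) (r ≫ pushout.inr c f)
        (by rw [reassoc_of% hr, hP.w])) r' (by
          apply hP'.hom_ext
          · simp [q, q', hr']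
          · simp [q, q', hh'])
      retract := by
        ext
        · apply hP.hom_ext
          · simp
          · simp [reassoc_of% hsr]
        · simpa using hsr' }

end HomotopyPushouts

/-! ### Commutation of colimits with pushouts -/

section Colimits

variable {C : Type u} [Category.{w} C] {K : Type w} [Category.{w} K]

/-- Colimits commute with pushouts: a pushout of colimits of functors is a colimit of
the pushout of these functors. -/
lemma exists_isColimit_of_isPushout {A B X P : K ⥤ C} {f : A ⟶ B} {g : A ⟶ X}
    {inl : B ⟶ P} {inr : X ⟶ P} (sq : IsPushout f g inl inr)
    {cA : Cocone A} {cB : Cocone B} {cX : Cocone X} (hA : IsColimit cA) (hB : IsColimit cB)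
    (hX : IsColimit cX) {φ : cA.pt ⟶ cB.pt} {ψ : cA.pt ⟶ cX.pt}
    (hφ : ∀ k, cA.ι.app k ≫ φ = f.app k ≫ cB.ι.app k)
    (hψ : ∀ k, cA.ι.app k ≫ ψ = g.app k ≫ cX.ι.app k)
    {Y : C} {a : cB.pt ⟶ Y} {b : cX.pt ⟶ Y} (hY : IsPushout φ ψ a b) :
    ∃ α : P ⟶ (Functor.const K).obj Y, Nonempty (IsColimit (Cocone.mk Y α)) ∧
      (∀ k, inl.app k ≫ α.app k = cB.ι.app k ≫ a) ∧
      (∀ k, inr.app k ≫ α.app k = cX.ι.app k ≫ b) := by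
  let α : P ⟶ (Functor.const K).obj Y :=
    sq.desc (cB.ι ≫ (Functor.const K).map a) (cX.ι ≫ (Functor.const K).map b) (by
      ext k
      simp [← reassoc_of% (hφ k), ← reassoc_of% (hψ k), hY.w])
  have hα₁ : ∀ k, inl.app k ≫ α.app k = cB.ι.app k ≫ a := fun k ↦
    NatTrans.congr_app (sq.inl_desc _ _ _) k
  have hα₂ : ∀ k, inr.app k ≫ α.app k = cX.ι.app k ≫ b := fun k ↦
    NatTrans.congr_app (sq.inr_desc _ _ _) k
  have hw : ∀ k, f.app k ≫ inl.app k = g.app k ≫ inr.app k := fun k ↦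
    NatTrans.congr_app sq.w k
  refine ⟨α, ⟨?_⟩, hα₁, hα₂⟩
  refine
    { desc s := hY.desc (hB.desc ⟨s.pt, inl ≫ s.ι⟩) (hX.desc ⟨s.pt, inr ≫ s.ι⟩) (by
        refine hA.hom_ext (fun k ↦ ?_)
        rw [reassoc_of% (hφ k), reassoc_of% (hψ k), hB.fac, hX.fac]
        simp [reassoc_of% (hw k)])
      fac s k := ?_
      uniq s m hm := ?_ }
  · have : α ≫ (Functor.const K).map (hY.desc (hB.desc ⟨s.pt, inl ≫ s.ι⟩)
        (hX.desc ⟨s.pt, inr ≫ s.ι⟩) (by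
        refine hA.hom_ext (fun k ↦ ?_)
        rw [reassoc_of% (hφ k), reassoc_of% (hψ k), hB.fac, hX.fac]
        simp [reassoc_of% (hw k)])) = s.ι := by
      apply sq.hom_ext
      · ext k
        have := hB.fac ⟨s.pt, inl ≫ s.ι⟩ k
        dsimp at this ⊢
        rw [reassoc_of% (hα₁ k), hY.inl_desc, this]
      · ext k
        have := hX.fac ⟨s.pt, inr ≫ s.ι⟩ k
        dsimp at this ⊢
        rw [reassoc_of% (hα₂ k), hY.inr_desc, this]
    exact NatTrans.congr_app this k
  · apply hY.hom_ext
    · rw [hY.inl_desc]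
      refine hB.hom_ext (fun k ↦ ?_)
      rw [hB.fac, ← reassoc_of% (hα₁ k)]
      simpa using congr_arg (inl.app k ≫ ·) (hm k)
    · rw [hY.inr_desc]
      refine hX.hom_ext (fun k ↦ ?_)
      rw [hX.fac, ← reassoc_of% (hα₂ k)]
      simpa using congr_arg (inr.app k ≫ ·) (hm k)

end Colimits

/-! ### Filtered colimits of flat maps and of homotopy pushouts -/

section FilteredColimits

variable {C : Type u} [Category.{w} C] [ModelCategory C]
  {K : Type w} [Category.{w} K] [IsFiltered K]

lemma weakEquivalence_of_isColimit (hfilt : FilteredColimitsHomotopical C)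
    {X Y : K ⥤ C} {cX : Cocone X} {cY : Cocone Y} (hX : IsColimit cX) (hY : IsColimit cY)
    (f : X ⟶ Y) (hf : ∀ k, WeakEquivalence (f.app k)) (φ : cX.pt ⟶ cY.pt)
    (hφ : ∀ k, cX.ι.app k ≫ φ = f.app k ≫ cY.ι.app k) : WeakEquivalence φ := by
  have := hfilt.isStableUnderColimitsOfShape K
  rw [weakEquivalence_iff]
  exact this.condition X Y cX cY hX hY f (fun k ↦ (hf k).mem) φ hφ

-- Filtered categories are connected, so constant diagrams have the expected colimit. Both pushouts
-- are then colimits of levelwise pushouts, and `w'` is a filtered colimit of weak equivalences.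
attribute [local instance] IsFiltered.isConnected in
lemma flatMorphisms_of_isColimit (hfilt : FilteredColimitsHomotopical C)
    {A B : K ⥤ C} {cA : Cocone A} {cB : Cocone B} (hA : IsColimit cA) (hB : IsColimit cB)
    (f : A ⟶ B) (hf : ∀ k, flatMorphisms C (f.app k)) (φ : cA.pt ⟶ cB.pt)
    (hφ : ∀ k, cA.ι.app k ≫ φ = f.app k ≫ cB.ι.app k) : flatMorphisms C φ := by
  intro X P X' P' g inl j w w' j' hP hP' hw
  let g' : A ⟶ (Functor.const K).obj X := cA.ι ≫ (Functor.const K).map g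
  have sq := IsPushout.of_hasPushout f g'
  have sq' := IsPushout.of_hasPushout (pushout.inr f g') ((Functor.const K).map w)
  have hX := isColimitConstCocone K X
  have hX' := isColimitConstCocone K X'
  obtain ⟨α, ⟨hα⟩, h₁, h₂⟩ := exists_isColimit_of_isPushout sq hA hB hX hφ
    (ψ := g) (fun k ↦ (Category.comp_id _).symm) hP
  obtain ⟨β, ⟨hβ⟩, h₃, h₄⟩ := exists_isColimit_of_isPushout sq' hX hα hX'
    (φ := j) (ψ := w) (fun k ↦ (h₂ k).symm)
    (fun k ↦ (Category.id_comp _).trans (Category.comp_id _).symm) hP'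
  refine weakEquivalence_of_isColimit hfilt hα hβ
    (pushout.inl (pushout.inr f g') ((Functor.const K).map w)) (fun k ↦ ?_) w' (fun k ↦ (h₃ k).symm)
  exact hf k _ _ _ _ _ _ (sq.map ((evaluation K C).obj k)) (sq'.map ((evaluation K C).obj k)) hw

/-- Homotopy pushouts are stable under filtered colimits. -/
lemma isHomotopyPushout_of_isColimit [HasColimitsOfShape K C] (hC : IsLeftProper C)
    (hfilt : FilteredColimitsHomotopical C)
    [(cofibrations C).HasFunctorialFactorization (trivialFibrations C)]
    {A B X Y : K ⥤ C} {f : A ⟶ B} {g : A ⟶ X} {h : B ⟶ Y} {k : X ⟶ Y}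
    (sq : ∀ j, IsHomotopyPushout (f.app j) (g.app j) (h.app j) (k.app j))
    {cA : Cocone A} {cB : Cocone B} {cX : Cocone X} {cY : Cocone Y}
    (hA : IsColimit cA) (hB : IsColimit cB) (hX : IsColimit cX) (hY : IsColimit cY)
    {f' : cA.pt ⟶ cB.pt} {g' : cA.pt ⟶ cX.pt} {h' : cB.pt ⟶ cY.pt} {k' : cX.pt ⟶ cY.pt}
    (hf : ∀ j, cA.ι.app j ≫ f' = f.app j ≫ cB.ι.app j)
    (hg : ∀ j, cA.ι.app j ≫ g' = g.app j ≫ cX.ι.app j)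
    (hh : ∀ j, cB.ι.app j ≫ h' = h.app j ≫ cY.ι.app j)
    (hk : ∀ j, cX.ι.app j ≫ k' = k.app j ≫ cY.ι.app j) :
    IsHomotopyPushout f' g' h' k' := by
  -- Functoriality allows `f` to be factored as a map of diagrams. In the colimit the first factor
  -- is only known to be flat, which suffices for testing homotopy pushouts.
  let F := ((MorphismProperty.functorialFactorizationData (cofibrations C)
    (trivialFibrations C)).functorCategory K).factorizationData f
  have hi : ∀ j, flatMorphisms C (F.i.app j) := fun j ↦
    flatMorphisms_of_cofibration hC _ ⟨F.hi j⟩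
  have hp : ∀ j, WeakEquivalence (F.p.app j) := fun j ↦ ⟨(F.hp j).2⟩
  have fac : ∀ j, F.i.app j ≫ F.p.app j = f.app j := fun j ↦ NatTrans.congr_app F.fac j
  have w : ∀ j, f.app j ≫ h.app j = g.app j ≫ k.app j := fun j ↦ (sq j).1.w
  have sqP := IsPushout.of_hasPushout F.i g
  let q : pushout F.i g ⟶ Y := sqP.desc (F.p ≫ h) k (by
    ext j
    simp [w j])
  have hq₁ : ∀ j, (pushout.inl F.i g).app j ≫ q.app j = F.p.app j ≫ h.app j := fun j ↦
    NatTrans.congr_app (sqP.inl_desc _ _ _) j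
  have hq₂ : ∀ j, (pushout.inr F.i g).app j ≫ q.app j = k.app j := fun j ↦
    NatTrans.congr_app (sqP.inr_desc _ _ _) j
  have hq : ∀ j, WeakEquivalence (q.app j) := fun j ↦
    (isHomotopyPushout_iff_of_flatMorphisms hC (sq j).1 (hi j) (hp j) (fac j)
      (sqP.map ((evaluation K C).obj j)) (hq₁ j) (hq₂ j)).1 (sq j)
  have hZ := colimit.isColimit F.Z
  let i' : cA.pt ⟶ colimit F.Z := hA.map (colimit.cocone F.Z) F.i
  have hi' : ∀ j, cA.ι.app j ≫ i' = F.i.app j ≫ colimit.ι F.Z j := fun j ↦ hA.ι_map _ _ _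
  let p' : colimit F.Z ⟶ cB.pt := colimit.desc F.Z ⟨cB.pt, F.p ≫ cB.ι⟩
  have hp' : ∀ j, colimit.ι F.Z j ≫ p' = F.p.app j ≫ cB.ι.app j := fun j ↦ by simp [p']
  have hP := IsPushout.of_hasPushout i' g'
  obtain ⟨α, ⟨hα⟩, h₁, h₂⟩ := exists_isColimit_of_isPushout sqP hA hZ hX hi' hg hP
  have fac' : i' ≫ p' = f' := hA.hom_ext (fun j ↦ by
    rw [reassoc_of% (hi' j), hp', reassoc_of% (fac j), hf])
  have w' : f' ≫ h' = g' ≫ k' := hA.hom_ext (fun j ↦ by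
    rw [reassoc_of% (hf j), hh, reassoc_of% (w j), reassoc_of% (hg j), hk])
  let q' : pushout i' g' ⟶ cY.pt := hP.desc (p' ≫ h') k' (by rw [reassoc_of% fac', w'])
  refine (isHomotopyPushout_iff_of_flatMorphisms hC ⟨w'⟩
    (flatMorphisms_of_isColimit hfilt hA hZ F.i hi i' hi')
    (weakEquivalence_of_isColimit hfilt hZ hB F.p hp p' hp') fac' hP (q := q')
    (hP.inl_desc _ _ _) (hP.inr_desc _ _ _)).2
    (weakEquivalence_of_isColimit hfilt hα hY q hq q' (fun j ↦ ?_))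
  refine (sqP.map ((evaluation K C).obj j)).hom_ext ?_ ?_
  · have := h₁ j
    dsimp at this ⊢
    rw [reassoc_of% this, reassoc_of% (hq₁ j), hP.inl_desc, ← hh, ← reassoc_of% (hp' j)]
  · have := h₂ j
    dsimp at this ⊢
    rw [reassoc_of% this, reassoc_of% (hq₂ j), hP.inr_desc, hk]

end FilteredColimits

/-! ### Closure under cell attachment from closure under filtered colimits -/

section CellClosure

variable {E : Type u} [Category.{w} E] (W : MorphismProperty E)

lemma isStableUnderTransfiniteComposition_of_filtered [W.IsMultiplicative] [W.RespectsIso]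
    (hW : ∀ (P : Type w) [PartialOrder P] [IsFiltered P], W.IsStableUnderColimitsOfShape P) :
    MorphismProperty.IsStableUnderTransfiniteComposition.{w} W where
  isStableUnderTransfiniteCompositionOfShape _ _ _ _ _ :=
    .of_isStableUnderColimitsOfShape (fun J _ _ _ _ ↦ hW J)

/-- The decomposition of a coproduct indexed by `Fin (n + 1)`. -/
noncomputable def coprodSigmaSuccIso [HasFiniteCoproducts E] {n : ℕ} (X : Fin (n + 1) → E) :
    (X 0 ⨿ ∐ fun i : Fin n ↦ X i.succ) ≅ ∐ X where
  hom := coprod.desc (Sigma.ι X 0) (Sigma.desc fun i ↦ Sigma.ι X i.succ)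
  inv := Sigma.desc (Fin.cases coprod.inl
    (fun i ↦ Sigma.ι (fun i : Fin n ↦ X i.succ) i ≫ coprod.inr))
  hom_inv_id := by
    refine coprod.hom_ext ?_ (Sigma.hom_ext _ _ (fun i ↦ ?_)) <;>
      simp [coprod.inl_desc, coprod.inr_desc]
  inv_hom_id := by
    refine Sigma.hom_ext _ _ (fun i ↦ ?_)
    induction i using Fin.cases <;> simp [coprod.inl_desc, coprod.inr_desc]

section Coproducts

variable [W.IsMultiplicative] [W.IsStableUnderCobaseChange]

/-- The map is `f ⨿ 𝟙` followed by `𝟙 ⨿ g`, and each of these is a cobase change. -/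
lemma coprod_map_mem [HasBinaryCoproducts E] {X₁ Y₁ X₂ Y₂ : E} (f : X₁ ⟶ Y₁) (g : X₂ ⟶ Y₂)
    (hf : W f) (hg : W g) : W (coprod.map f g) := by
  have h₁ : W (coprod.map f (𝟙 X₂)) :=
    W.of_isPushout (IsPushout.of_coprod_inl_with_id f X₂) hf
  have h₂ : W (coprod.map (𝟙 Y₁) g) := by
    have h := W.of_isPushout (IsPushout.of_coprod_inl_with_id g Y₁) hg
    refine (W.arrow_mk_iso_iff (Arrow.isoMk (coprod.braiding _ _) (coprod.braiding _ _) ?_)).1 h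
    dsimp
    ext <;> simp
  have := W.comp_mem _ _ h₁ h₂
  rwa [coprod.map_map, Category.comp_id, Category.id_comp] at this

lemma isStableUnderCoproductsOfShape_fin [HasFiniteCoproducts E] (n : ℕ) :
    W.IsStableUnderCoproductsOfShape (Fin n) := by
  induction n with
  | zero =>
    refine MorphismProperty.IsStableUnderCoproductsOfShape.mk _ _ (fun X₁ X₂ _ _ f _ ↦ ?_)
    have : IsIso (Limits.Sigma.map f) :=
      ⟨Sigma.desc (fun i ↦ i.elim0), by ext i; exact i.elim0, by ext i; exact i.elim0⟩
    exact W.of_isIso _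
  | succ n ih =>
    refine MorphismProperty.IsStableUnderCoproductsOfShape.mk _ _ (fun X₁ X₂ _ _ f hf ↦ ?_)
    have h₁ : W (Limits.Sigma.map (fun i : Fin n ↦ f i.succ)) :=
      MorphismProperty.colimMap _ (fun ⟨i⟩ ↦ hf i.succ)
    have h₂ := coprod_map_mem W (f 0) _ (hf 0) h₁
    refine (W.arrow_mk_iso_iff
      (Arrow.isoMk (coprodSigmaSuccIso X₁) (coprodSigmaSuccIso X₂) ?_)).1 h₂
    refine coprod.hom_ext ?_ (Sigma.hom_ext _ _ (fun i ↦ ?_)) <;>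
      simp [coprodSigmaSuccIso, coprod.inl_desc, coprod.inr_desc]

lemma isStableUnderCoproductsOfShape_of_finite [HasFiniteCoproducts E] (α : Type*) [Finite α] :
    W.IsStableUnderCoproductsOfShape α := by
  obtain ⟨n, ⟨e⟩⟩ := Finite.exists_equiv_fin α
  have := isStableUnderCoproductsOfShape_fin W n
  unfold MorphismProperty.IsStableUnderCoproductsOfShape at this ⊢
  rw [MorphismProperty.isStableUnderColimitsOfShape_iff_colimitsOfShape_le] at this ⊢
  rwa [W.colimitsOfShape_eq_of_equivalence (Discrete.equivalence e)]

variable [HasColimitsOfSize.{w, w} E]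
  (hW : ∀ (P : Type w) [PartialOrder P] [IsFiltered P], W.IsStableUnderColimitsOfShape P)

include hW

-- A coproduct is the colimit of its finite subcoproducts over the directed poset of finite subsets.
open CoproductsFromFiniteFiltered in
lemma isStableUnderCoproducts_of_filtered :
    MorphismProperty.IsStableUnderCoproducts.{w} W where
  isStableUnderCoproductsOfShape α := by
    have : HasFiniteCoproducts E := hasFiniteCoproducts_of_hasCoproducts E
    refine MorphismProperty.IsStableUnderCoproductsOfShape.mk _ _ (fun X₁ X₂ _ _ f hf ↦ ?_)
    refine (hW (Finset (Discrete α))).condition _ _ _ _ (isColimitFiniteSubproductsCocone X₁)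
      (isColimitFiniteSubproductsCocone X₂)
      ((liftToFinset E α).map (Discrete.natTrans (fun ⟨i⟩ ↦ f i))) (fun S ↦ ?_) _ (fun S ↦ ?_)
    · have := isStableUnderCoproductsOfShape_of_finite W S
      exact MorphismProperty.colimMap _ (fun ⟨i⟩ ↦ hf i.1.as)
    · refine Sigma.hom_ext _ _ (fun i ↦ ?_)
      change Sigma.ι (fun x : S ↦ X₁ x.1.as) i ≫
          (Limits.Sigma.desc fun s : S ↦ Sigma.ι X₁ s.1.as) ≫ Limits.Sigma.map f =
        Sigma.ι (fun x : S ↦ X₁ x.1.as) i ≫ Limits.Sigma.map (fun x : S ↦ f x.1.as) ≫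
          Limits.Sigma.desc (fun s : S ↦ Sigma.ι X₂ s.1.as)
      simp

/-- A class of morphisms stable under cobase change, composition and colimits indexed by filtered
posets contains the relative cell complexes with cells in it. -/
lemma transfiniteCompositions_pushouts_coproducts_le {I : MorphismProperty E} (hI : I ≤ W) :
    MorphismProperty.transfiniteCompositions.{w}
      (MorphismProperty.coproducts.{w} I).pushouts ≤ W := by
  have := isStableUnderCoproducts_of_filtered W hW
  have := isStableUnderTransfiniteComposition_of_filtered W hW
  simpa

lemma llp_rlp_le_of_filtered [W.IsStableUnderRetracts] {I : MorphismProperty E}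
    (hI : I ≤ W) [MorphismProperty.HasSmallObjectArgument.{w} I] : I.rlp.llp ≤ W := by
  rw [MorphismProperty.llp_rlp_of_hasSmallObjectArgument]
  refine (MorphismProperty.retracts_monotone
    (transfiniteCompositions_pushouts_coproducts_le W hW hI)).trans ?_
  exact MorphismProperty.retracts_le W

end Coproducts

end CellClosure

/-! ### Limits, colimits and smallness in locally presentable categories -/

section LocallyPresentable

variable (D : Type u') [Category.{w} D] [IsLocallyPresentable.{w} D]

lemma hasColimitsOfSize_of_isLocallyPresentable : HasColimitsOfSize.{w, w} D := by
  obtain ⟨κ, _, _⟩ := IsLocallyPresentable.exists_cardinal.{w} D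
  infer_instance

/-- A locally presentable category is a reflective subcategory of a category of presheaves on
a small category, and is therefore complete. -/
lemma hasLimitsOfSize_of_isLocallyPresentable : HasLimitsOfSize.{w, w} D := by
  obtain ⟨κ, _, _⟩ := IsLocallyPresentable.exists_cardinal.{w} D
  let A : SmallModel.{w} (isCardinalPresentable D κ).FullSubcategory ⥤ D :=
    (equivSmallModel.{w} (isCardinalPresentable D κ).FullSubcategory).inverse ⋙
      (isCardinalPresentable D κ).ι
  let R := Presheaf.restrictedULiftYoneda.{w} A
  have : Reflective R :=
    { L := uliftYoneda.{w}.leftKanExtension A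
      adj := Presheaf.uliftYonedaAdjunction.{w} _ (uliftYoneda.leftKanExtensionUnit A) }
  exact hasLimits_of_reflective R

variable {D}

/-- Every object is presentable for some regular cardinal, and a small family of such cardinals is
dominated by one regular `μ`. -/
lemma hasSmallObjectArgument_of_isSmall (I : MorphismProperty D)
    [MorphismProperty.IsSmall.{w} I] : MorphismProperty.HasSmallObjectArgument.{w} I := by
  have := hasColimitsOfSize_of_isLocallyPresentable D
  have hpres (i : I.toSet) : ∃ (κ : Cardinal.{w}) (_ : Fact κ.IsRegular),
      IsCardinalPresentable i.1.left κ :=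
    Functor.IsAccessible.exists_cardinal (F := coyoneda.obj (Opposite.op i.1.left))
  choose κ hκ hκ' using hpres
  obtain ⟨μ, hμ, hμ'⟩ :=
    HasCardinalLT.exists_regular_cardinal_forall.{w} (fun i ↦ (κ i).ord.ToType)
  have : Fact μ.IsRegular := ⟨hμ⟩
  have : Nonempty μ.ord.ToType := by simpa using hμ.ne_zero
  have := WellFoundedLT.toOrderBot μ.ord.ToType
  refine ⟨μ, inferInstance, inferInstance, { preservesColimit {A B X Y} i hi f hf := ?_ }⟩
  have := hκ ⟨Arrow.mk i, hi⟩
  have : IsCardinalPresentable A (κ ⟨Arrow.mk i, hi⟩) := hκ' ⟨Arrow.mk i, hi⟩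
  have : IsCardinalPresentable A μ := isCardinalPresentable_of_le A (κ := κ ⟨Arrow.mk i, hi⟩)
    (le_of_lt (by simpa [hasCardinalLT_iff_cardinal_mk_lt] using hμ' ⟨Arrow.mk i, hi⟩))
  have := preservesColimitsOfShape_of_isCardinalPresentable A μ μ.ord.ToType
  infer_instance

end LocallyPresentable

lemma isSmall_strictMap {C : Type u} [Category.{w} C] {D : Type u'} [Category.{w} D]
    (I : MorphismProperty C) [MorphismProperty.IsSmall.{w} I] (F : C ⥤ D) :
    MorphismProperty.IsSmall.{w} (I.strictMap F) where
  small_toSet := by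
    refine small_of_surjective (α := I.toSet)
      (f := fun i ↦ ⟨Arrow.mk (F.map i.1.hom), ⟨i.2⟩⟩) ?_
    rintro ⟨⟨_, _, f⟩, hf⟩
    change I.strictMap F f at hf
    obtain ⟨hf⟩ := hf
    exact ⟨⟨Arrow.mk _, hf⟩, rfl⟩

lemma rlp_strictMap {C : Type u} [Category.{w} C] {D : Type u'} [Category.{w} D]
    (I : MorphismProperty C) {F : C ⥤ D} {U : D ⥤ C} (adj : F ⊣ U) :
    (I.strictMap F).rlp = I.rlp.inverseImage U := by
  ext X Y p
  constructor
  · intro hp A B i hi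
    exact (adj.hasLiftingProperty_iff i p).1 (hp _ ⟨hi⟩)
  · rintro hp _ _ _ ⟨hi⟩
    exact (adj.hasLiftingProperty_iff _ p).2 (hp _ hi)

/-! ### Closure properties of homotopy flat maps -/

section HomotopyFlat

variable {C : Type u} [Category.{w} C] [ModelCategory C] {D : Type u'} [Category.{w} D]

/-- The morphisms in `D` whose pushouts are sent to homotopy pushouts by `U`. -/
def homotopyFlatMorphisms (U : D ⥤ C) : MorphismProperty D := fun X Y f ↦
  ∀ ⦃Z W : D⦄ (g : X ⟶ Z) (h : Y ⟶ W) (k : Z ⟶ W), IsPushout f g h k →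
    IsHomotopyPushout (U.map f) (U.map g) (U.map h) (U.map k)

variable (hC : IsLeftProper C) (U : D ⥤ C)

include hC in
lemma isStableUnderCobaseChange_homotopyFlatMorphisms :
    (homotopyFlatMorphisms U).IsStableUnderCobaseChange where
  of_isPushout sq hf := fun _ _ g h k sq' ↦ by
    have h₁ := hf _ _ _ sq.flip
    have h₂ := hf _ _ _ (sq.flip.paste_vert sq')
    rw [U.map_comp, U.map_comp, h₁.paste_vert_iff hC (sq'.toCommSq.map U)] at h₂
    exact h₂

include hC in
lemma isMultiplicative_homotopyFlatMorphisms [HasPushouts D] :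
    (homotopyFlatMorphisms U).IsMultiplicative where
  id_mem X Z W g h k sq := by
    have : IsIso k := sq.isIso_inr_of_isIso
    refine (isHomotopyPushout_iff_of_weakEquivalence_top hC (sq.toCommSq.map U) ?_).2
      inferInstance
    rw [U.map_id]
    infer_instance
  comp_mem f f' hf hf' Z W g h k sq := by
    have sq₁ := IsPushout.of_hasPushout f g
    have sq₂ := sq.of_left' sq₁
    have h₁ := hf _ _ _ sq₁
    have h₂ := hf' _ _ _ sq₂
    have := (h₁.paste_horiz_iff hC (sq₂.toCommSq.map U)).2 h₂
    rwa [← U.map_comp, ← U.map_comp, sq₁.inr_desc] at this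

include hC in
lemma isStableUnderRetracts_homotopyFlatMorphisms [HasPushouts D] :
    (homotopyFlatMorphisms U).IsStableUnderRetracts where
  of_retract {X Y X' Y' f f'} e hf' Z W g h k sq := by
    have := isStableUnderCobaseChange_homotopyFlatMorphisms hC U
    have sq₁ := IsPushout.of_hasPushout f' e.r.left
    -- Pushing `f'` out along `e.r.left` yields a map `f''` out of `X` of which `f` is a retract
    -- under `X`. Retracts with fixed source are handled by `IsHomotopyPushout.of_retract`.
    have hr : f' ≫ e.r.right = e.r.left ≫ f := e.r.w.symm
    have hi : f ≫ e.i.right = e.i.left ≫ f' := e.i.w.symm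
    have er : e.i.right ≫ e.r.right = 𝟙 _ := congr_arg Arrow.Hom.right e.retract
    have el : e.i.left ≫ e.r.left = 𝟙 _ := congr_arg CommaMorphism.left e.retract
    let f'' := pushout.inr f' e.r.left
    have hf'' : homotopyFlatMorphisms U f'' :=
      (homotopyFlatMorphisms U).of_isPushout sq₁.flip hf'
    have sq₂ := IsPushout.of_hasPushout f'' g
    let s : Y ⟶ pushout f' e.r.left := e.i.right ≫ pushout.inl _ _
    let r : pushout f' e.r.left ⟶ Y := sq₁.desc e.r.right f hr
    have hs : f ≫ s = f'' := by
      simp only [s, f'', reassoc_of% hi, sq₁.w, reassoc_of% el]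
    have hr' : f'' ≫ r = f := sq₁.inr_desc _ _ _
    have hsr : s ≫ r = 𝟙 Y := by simp [s, r, er]
    let s' : W ⟶ pushout f'' g := sq.desc (s ≫ pushout.inl _ _) (pushout.inr _ _) (by
      rw [reassoc_of% hs, sq₂.w])
    let r' : pushout f'' g ⟶ W := sq₂.desc (r ≫ h) k (by rw [reassoc_of% hr', sq.w])
    have hsr' : s' ≫ r' = 𝟙 W := by
      apply sq.hom_ext
      · simp [s', r', reassoc_of% hsr]
      · simp [s', r']
    refine (hf'' _ _ _ sq₂).of_retract hC (sq.toCommSq.map U) (s := U.map s) (r := U.map r)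
      (s' := U.map s') (r' := U.map r') ?_ ?_ ?_ ?_ ?_ ?_ ?_ ?_
    all_goals rw [← U.map_comp]
    · rw [hsr, U.map_id]
    · rw [hs]
    · rw [hr']
    · rw [hsr', U.map_id]
    · simp [s']
    · simp [r']
    · rw [← U.map_comp]
      simp [s']
    · rw [← U.map_comp]
      simp [r']

-- The square is a filtered colimit of pushouts of the `f.app j`. Their images under `U` are
-- homotopy pushouts, hence so is the colimit of these images, and by `hcolim` it is weakly
-- equivalent to the image of the original square.
attribute [local instance] IsFiltered.isConnected in
include hC in
lemma isStableUnderColimitsOfShape_homotopyFlatMorphisms [HasPushouts D]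
    [HasColimitsOfSize.{w, w} C]
    [(cofibrations C).HasFunctorialFactorization (trivialFibrations C)]
    (hfilt : FilteredColimitsHomotopical C)
    (hcolim : PreservesFilteredColimitsUpToWeakEquivalence U)
    (P : Type w) [PartialOrder P] [IsFiltered P] :
    (homotopyFlatMorphisms U).IsStableUnderColimitsOfShape P where
  condition X₁ X₂ c₁ c₂ h₁ h₂ f hf φ hφ Z W g h k sq := by
    let g' : X₁ ⟶ (Functor.const P).obj Z := c₁.ι ≫ (Functor.const P).map g
    have sqK := IsPushout.of_hasPushout f g'
    have hZ := isColimitConstCocone P Z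
    obtain ⟨α, ⟨hα⟩, hα₁, hα₂⟩ := exists_isColimit_of_isPushout sqK h₁ h₂ hZ hφ (ψ := g)
      (fun k ↦ (Category.comp_id _).symm) sq
    have hp := isHomotopyPushout_of_isColimit hC hfilt
      (f := Functor.whiskerRight f U) (g := Functor.whiskerRight g' U)
      (h := Functor.whiskerRight (pushout.inl f g') U)
      (k := Functor.whiskerRight (pushout.inr f g') U)
      (fun j ↦ hf j _ _ _ (sqK.map ((evaluation P D).obj j)))
      (colimit.isColimit _) (colimit.isColimit _) (colimit.isColimit _) (colimit.isColimit _)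
      (f' := colimMap _) (g' := colimMap _) (h' := colimMap _) (k' := colimMap _)
      (fun j ↦ ι_colimMap _ _) (fun j ↦ ι_colimMap _ _) (fun j ↦ ι_colimMap _ _)
      (fun j ↦ ι_colimMap _ _)
    have compat {A B : P ⥤ D} (t : A ⟶ B) {cA : Cocone A} {cB : Cocone B}
        (t' : cA.pt ⟶ cB.pt) (ht : ∀ j, t.app j ≫ cB.ι.app j = cA.ι.app j ≫ t') :
        colimMap (Functor.whiskerRight t U) ≫ colimit.desc (B ⋙ U) (U.mapCocone cB) =
          colimit.desc (A ⋙ U) (U.mapCocone cA) ≫ U.map t' := by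
      refine colimit.hom_ext (fun j ↦ ?_)
      rw [ι_colimMap_assoc, colimit.ι_desc, colimit.ι_desc_assoc]
      dsimp
      rw [← U.map_comp, ← U.map_comp, ht]
    exact (isHomotopyPushout_iff_of_weakEquivalences hC hp.1 (sq.toCommSq.map U)
      (compat f φ (fun j ↦ (hφ j).symm))
      (compat g' (cB := constCocone P Z) g (fun j ↦ Category.comp_id _))
      (compat _ (cB := Cocone.mk W α) h hα₁)
      (compat _ (cA := constCocone P Z) (cB := Cocone.mk W α) k hα₂)
      (hcolim P X₁ c₁ h₁) (hcolim P X₂ c₂ h₂) (hcolim P _ _ hZ) (hcolim P _ _ hα)).1 hp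

end HomotopyFlat

/-! ### Homotopy pullbacks, by passage to the opposite category -/

section HomotopyPullbacks

variable {C : Type u} [Category.{w} C] [ModelCategory C]

lemma isLeftProper_op (hC : IsRightProper C) : IsLeftProper Cᵒᵖ := by
  intro A B A' B' f i i' f' sq hi hf
  rw [← weakEquivalences_unop_iff] at hf ⊢
  exact hC f'.unop i'.unop i.unop f.unop sq.unop ((fibration_unop_iff i).2 hi) hf

/-- Homotopy pullbacks can be tested using any factorization into a weak equivalence
followed by a fibration. -/
lemma isHomotopyPullback_iff_of_fibration (hC : IsRightProper C) {A B X Y : C}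
    {f : A ⟶ B} {g : A ⟶ X} {h : B ⟶ Y} {k : X ⟶ Y} (sq : CommSq f g h k)
    {B' P : C} {j : B ⟶ B'} {p : B' ⟶ Y} {fst : P ⟶ B'} {snd : P ⟶ X} {q : A ⟶ P}
    (hj : WeakEquivalence j) (hp : Fibration p) (fac : j ≫ p = h)
    (hP : IsPullback fst snd p k) (hq₁ : q ≫ fst = f ≫ j) (hq₂ : q ≫ snd = g) :
    IsHomotopyPullback f g h k ↔ WeakEquivalence q := by
  constructor
  · rintro ⟨-, B₁, P₁, j₁, p₁, fst₁, snd₁, q₁, hj₁, hp₁, fac₁, hP₁, e₁, e₂, hq⟩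
    have hpush : IsHomotopyPushout h.op k.op f.op g.op :=
      ⟨⟨by simp only [← op_comp, sq.w]⟩, _, _, p₁.op, j₁.op, fst₁.op, snd₁.op, q₁.op,
        inferInstance, inferInstance, by simp [← op_comp, fac₁], hP₁.op.flip,
        by simp only [← op_comp, e₁], by simp only [← op_comp, e₂], inferInstance⟩
    have := (isHomotopyPushout_iff_of_flatMorphisms (isLeftProper_op hC) hpush.1
      (flatMorphisms_of_cofibration (isLeftProper_op hC) p.op inferInstance)
      (p := j.op) inferInstance (by simp [← op_comp, fac]) hP.op.flip (q := q.op)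
      (by simp only [← op_comp, hq₁]) (by simp only [← op_comp, hq₂])).1 hpush
    exact (weakEquivalences_op_iff q).1 this
  · intro hq
    exact ⟨sq, B', P, j, p, fst, snd, q, hj, hp, fac, hP, hq₁, hq₂, hq⟩

end HomotopyPullbacks

/-! ### The acyclicity condition -/

section Transfer

variable {C : Type u} [Category.{w} C] [ModelCategory C] {D : Type u'} [Category.{w} D]

section

variable {I J : MorphismProperty C} (hIJ : IsCofibrantlyGenerated I J)

include hIJ

lemma IsCofibrantlyGenerated.cofibrations_eq : cofibrations C = I.rlp.llp := by
  rw [← hIJ.trivialFibrations_eq, trivialFibrations_llp]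

lemma IsCofibrantlyGenerated.trivialCofibrations_eq : trivialCofibrations C = J.rlp.llp := by
  rw [← hIJ.fibrations_eq, fibrations_llp]

lemma IsCofibrantlyGenerated.hasFunctorialFactorization :
    (cofibrations C).HasFunctorialFactorization (trivialFibrations C) := by
  have := hIJ.smallObjectArgument_I
  rw [hIJ.cofibrations_eq, hIJ.trivialFibrations_eq]
  infer_instance

lemma IsCofibrantlyGenerated.isSmall_I : MorphismProperty.IsSmall.{w} I := by
  obtain ⟨κ, _, _, _⟩ := hIJ.smallObjectArgument_I
  exact SmallObject.isSmall I κ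

lemma IsCofibrantlyGenerated.isSmall_J : MorphismProperty.IsSmall.{w} J := by
  obtain ⟨κ, _, _, _⟩ := hIJ.smallObjectArgument_J
  exact SmallObject.isSmall J κ

lemma IsCofibrantlyGenerated.rlp_strictMap_le {F : C ⥤ D} {U : D ⥤ C} (adj : F ⊣ U) :
    (I.strictMap F).rlp ≤ (J.strictMap F).rlp := by
  rw [rlp_strictMap I adj, rlp_strictMap J adj, ← hIJ.trivialFibrations_eq, ← hIJ.fibrations_eq]
  exact fun _ _ _ h ↦ h.1

end

section WeakEquivalences

variable (U : D ⥤ C) [HasColimitsOfSize.{w, w} C] (hfilt : FilteredColimitsHomotopical C)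
  (hcolim : PreservesFilteredColimitsUpToWeakEquivalence U)

include hfilt hcolim

lemma isStableUnderColimitsOfShape_inverseImage_weakEquivalences
    (P : Type w) [PartialOrder P] [IsFiltered P] :
    ((weakEquivalences C).inverseImage U).IsStableUnderColimitsOfShape P where
  condition X₁ X₂ c₁ c₂ h₁ h₂ f hf φ hφ := by
    have hf' : WeakEquivalence (colimMap (Functor.whiskerRight f U)) :=
      weakEquivalence_of_isColimit hfilt (colimit.isColimit _) (colimit.isColimit _)
        (Functor.whiskerRight f U) (fun j ↦ ⟨hf j⟩) _ (fun j ↦ ι_colimMap _ _)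
    have := hcolim P X₁ c₁ h₁
    have := hcolim P X₂ c₂ h₂
    have fac : colimit.desc (X₁ ⋙ U) (U.mapCocone c₁) ≫ U.map φ =
        colimMap (Functor.whiskerRight f U) ≫ colimit.desc (X₂ ⋙ U) (U.mapCocone c₂) := by
      refine colimit.hom_ext (fun j ↦ ?_)
      rw [ι_colimMap_assoc, colimit.ι_desc, colimit.ι_desc_assoc]
      dsimp
      rw [← U.map_comp, ← U.map_comp, hφ]
    have : WeakEquivalence (U.map φ) := weakEquivalence_of_precomp_of_fac fac
    exact this.mem

lemma isStableUnderFilteredColimits_inverseImage_weakEquivalences :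
    MorphismProperty.IsStableUnderFilteredColimits.{w, w}
      ((weakEquivalences C).inverseImage U) where
  isStableUnderColimitsOfShape K _ _ := by
    -- The hypothesis `hcolim` concerns posets only; a final functor from a directed poset reduces
    -- the general case to it.
    obtain ⟨P, _, _, _, G, _⟩ := IsFiltered.exists_directed K
    have := isStableUnderColimitsOfShape_inverseImage_weakEquivalences U hfilt hcolim P
    rw [MorphismProperty.isStableUnderColimitsOfShape_iff_colimitsOfShape_le] at this ⊢
    exact (MorphismProperty.colimitsOfShape_le_of_final _ G).trans this

lemma isStableUnderColimitsOfShape_homotopyFlatMorphisms_inf [HasPushouts D]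
    (hC : IsLeftProper C)
    [(cofibrations C).HasFunctorialFactorization (trivialFibrations C)]
    (P : Type w) [PartialOrder P] [IsFiltered P] :
    (homotopyFlatMorphisms U ⊓ (weakEquivalences C).inverseImage U).IsStableUnderColimitsOfShape
      P where
  condition X₁ X₂ c₁ c₂ h₁ h₂ f hf φ hφ :=
    ⟨(isStableUnderColimitsOfShape_homotopyFlatMorphisms hC U hfilt hcolim P).condition X₁ X₂ c₁ c₂
      h₁ h₂ f (fun j ↦ (hf j).1) φ hφ,
    (isStableUnderColimitsOfShape_inverseImage_weakEquivalences U hfilt hcolim P).condition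
      X₁ X₂ c₁ c₂ h₁ h₂ f (fun j ↦ (hf j).2) φ hφ⟩

end WeakEquivalences

/-- Homotopy flatness is what makes the weak equivalences stable here: in a homotopy pushout, the
edge parallel to a weak equivalence is one too. -/
lemma isStableUnderCobaseChange_homotopyFlatMorphisms_inf (hC : IsLeftProper C) (U : D ⥤ C) :
    (homotopyFlatMorphisms U ⊓
      (weakEquivalences C).inverseImage U).IsStableUnderCobaseChange where
  of_isPushout sq hf := by
    have := isStableUnderCobaseChange_homotopyFlatMorphisms hC U
    refine ⟨(homotopyFlatMorphisms U).of_isPushout sq hf.1, ?_⟩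
    exact ((isHomotopyPushout_iff_of_weakEquivalence_top hC (sq.flip.toCommSq.map U) ⟨hf.2⟩).1
      (hf.1 _ _ _ sq.flip)).mem

section

variable [HasColimitsOfSize.{w, w} C] [IsLocallyPresentable.{w} D]
  {F : C ⥤ D} {U : D ⥤ C} (adj : F ⊣ U) {I J : MorphismProperty C}
  (hIJ : IsCofibrantlyGenerated I J) (hC : IsLeftProper C)
  (hfilt : FilteredColimitsHomotopical C)
  (hcolim : PreservesFilteredColimitsUpToWeakEquivalence U)
  (hpush : I.strictMap F ≤ homotopyFlatMorphisms U)

include hIJ hC hfilt hcolim hpush in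
lemma llp_rlp_strictMap_le_homotopyFlatMorphisms :
    (I.strictMap F).rlp.llp ≤ homotopyFlatMorphisms U := by
  have := hIJ.hasFunctorialFactorization
  have := hIJ.isSmall_I
  have := isSmall_strictMap I F
  have := hasSmallObjectArgument_of_isSmall (I.strictMap F)
  have := hasColimitsOfSize_of_isLocallyPresentable.{w} D
  have := isStableUnderCobaseChange_homotopyFlatMorphisms hC U
  have := isMultiplicative_homotopyFlatMorphisms hC U
  have := isStableUnderRetracts_homotopyFlatMorphisms hC U
  exact llp_rlp_le_of_filtered _
    (isStableUnderColimitsOfShape_homotopyFlatMorphisms hC U hfilt hcolim) hpush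

include adj hIJ hC hfilt hcolim hpush in
lemma llp_rlp_strictMap_le_weakEquivalences
    (hJ : J.strictMap F ≤ (weakEquivalences C).inverseImage U) :
    (J.strictMap F).rlp.llp ≤ (weakEquivalences C).inverseImage U := by
  have := hIJ.hasFunctorialFactorization
  have := hIJ.isSmall_J
  have := isSmall_strictMap J F
  have := hasSmallObjectArgument_of_isSmall (J.strictMap F)
  have := hasColimitsOfSize_of_isLocallyPresentable.{w} D
  have := isStableUnderCobaseChange_homotopyFlatMorphisms_inf hC U
  have := isMultiplicative_homotopyFlatMorphisms hC U
  have := isStableUnderRetracts_homotopyFlatMorphisms hC U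
  have h₁ : J.strictMap F ≤ homotopyFlatMorphisms U ⊓ (weakEquivalences C).inverseImage U :=
    le_inf ((MorphismProperty.le_llp_rlp _).trans
      ((MorphismProperty.antitone_llp (hIJ.rlp_strictMap_le adj)).trans
        (llp_rlp_strictMap_le_homotopyFlatMorphisms hIJ hC hfilt hcolim hpush))) hJ
  exact (llp_rlp_le_of_filtered _ (isStableUnderColimitsOfShape_homotopyFlatMorphisms_inf U
    hfilt hcolim hC) h₁).trans inf_le_right

end

end Transfer

/-! ### The transferred model structure and its properties -/

section ModelStructure

variable {C : Type u} [Category.{w} C] [ModelCategory C] {D : Type u'} [Category.{w} D]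

lemma modelCategory_ext {M M' : ModelCategory D}
    (hf : M.categoryWithFibrations.fibrations = M'.categoryWithFibrations.fibrations)
    (hc : M.categoryWithCofibrations.cofibrations = M'.categoryWithCofibrations.cofibrations)
    (hw : M.categoryWithWeakEquivalences.weakEquivalences =
      M'.categoryWithWeakEquivalences.weakEquivalences) : M = M' := by
  obtain ⟨⟨f⟩, ⟨c⟩, ⟨w⟩⟩ := M
  obtain ⟨⟨f'⟩, ⟨c'⟩, ⟨w'⟩⟩ := M'
  obtain rfl : f = f' := hf
  obtain rfl : c = c' := hc
  obtain rfl : w = w' := hw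
  rfl

/-- Cofibrations are determined by the other two classes, through lifting against acyclic
fibrations. -/
lemma IsTransferred.eq {U : D ⥤ C} {M M' : ModelCategory D} (hM : IsTransferred U M)
    (hM' : IsTransferred U M') : M = M' := by
  have hf := hM.2.trans hM'.2.symm
  have hw := hM.1.trans hM'.1.symm
  have ht : @trivialFibrations D _ M.categoryWithFibrations M.categoryWithWeakEquivalences =
      @trivialFibrations D _ M'.categoryWithFibrations M'.categoryWithWeakEquivalences := by
    unfold trivialFibrations
    rw [hf, hw]
  refine modelCategory_ext hf ?_ hw
  have h : ∀ N : ModelCategory D, (trivialFibrations D).llp = cofibrations D :=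
    fun _ ↦ trivialFibrations_llp D
  calc
    _ = _ := (h M).symm
    _ = _ := congr_arg MorphismProperty.llp ht
    _ = _ := h _

/-- The transferred model structure exists as soon as the relative cell complexes
with cells in `F J` are sent to weak equivalences by `U`. -/
lemma exists_isTransferred [IsLocallyPresentable.{w} D]
    {F : C ⥤ D} {U : D ⥤ C} (adj : F ⊣ U) {I J : MorphismProperty C}
    (hIJ : IsCofibrantlyGenerated I J)
    (hJ : (J.strictMap F).rlp.llp ≤ (weakEquivalences C).inverseImage U) :
    ∃ M : ModelCategory D, IsTransferred U M := by
  have := hIJ.isSmall_I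
  have := hIJ.isSmall_J
  have := isSmall_strictMap I F
  have := isSmall_strictMap J F
  have := hasSmallObjectArgument_of_isSmall (I.strictMap F)
  have := hasSmallObjectArgument_of_isSmall (J.strictMap F)
  have := hasColimitsOfSize_of_isLocallyPresentable.{w} D
  have := hasLimitsOfSize_of_isLocallyPresentable.{w} D
  have : HasFiniteLimits D := hasFiniteLimits_of_hasLimitsOfSize.{w, w} D
  have : HasFiniteColimits D := hasFiniteColimits_of_hasColimitsOfSize.{w, w} D
  let _ : CategoryWithFibrations D := ⟨(fibrations C).inverseImage U⟩
  let _ : CategoryWithCofibrations D := ⟨(I.strictMap F).rlp.llp⟩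
  let _ : CategoryWithWeakEquivalences D := ⟨(weakEquivalences C).inverseImage U⟩
  have hcof : cofibrations D = (I.strictMap F).rlp.llp := rfl
  have hwe : weakEquivalences D = (weakEquivalences C).inverseImage U := rfl
  have hfib' : fibrations D = (fibrations C).inverseImage U := rfl
  have hfib : fibrations D = (J.strictMap F).rlp := by
    rw [rlp_strictMap J adj, ← hIJ.fibrations_eq, hfib']
  have htfib : trivialFibrations D = (I.strictMap F).rlp := by
    rw [rlp_strictMap I adj, ← hIJ.trivialFibrations_eq]
    rfl
  have htcof : trivialCofibrations D = (J.strictMap F).rlp.llp := by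
    apply le_antisymm
    · intro A B i hi
      -- By two-out-of-three `h.p` is an acyclic fibration, so `i` lifts against it and is a retract
      -- of `h.i`.
      let h := MorphismProperty.factorizationData (J.strictMap F).rlp.llp (J.strictMap F).rlp i
      have hp : (I.strictMap F).rlp h.p := by
        rw [← htfib]
        refine ⟨by rw [hfib]; exact h.hp, ?_⟩
        have h₁ : weakEquivalences C (U.map h.i) := hJ _ h.hi
        have h₂ : weakEquivalences C (U.map h.i ≫ U.map h.p) := by
          rw [← U.map_comp, h.fac]
          exact hi.2
        exact (weakEquivalences C).of_precomp (U.map h.i) (U.map h.p) h₁ h₂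
      have : HasLiftingProperty i h.p := hi.1 _ hp
      exact MorphismProperty.of_retract (RetractArrow.ofLeftLiftingProperty h.fac) h.hi
    · exact le_inf (MorphismProperty.antitone_llp (hIJ.rlp_strictMap_le adj)) hJ
  have : (weakEquivalences D).HasTwoOutOfThreeProperty := by
    rw [hwe]
    infer_instance
  have : MorphismProperty.IsWeakFactorizationSystem (cofibrations D) (trivialFibrations D) := by
    rw [hcof, htfib]
    exact ⟨MorphismProperty.rlp_llp_rlp _, rfl, inferInstance⟩
  have : MorphismProperty.IsWeakFactorizationSystem (trivialCofibrations D) (fibrations D) := by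
    rw [htcof, hfib]
    exact ⟨MorphismProperty.rlp_llp_rlp _, rfl, inferInstance⟩
  exact ⟨ModelCategory.mk' D, rfl, rfl⟩

section

variable {U : D ⥤ C} [M : ModelCategory D] (hM : IsTransferred U M)

include hM

lemma IsTransferred.weakEquivalence_iff {X Y : D} (f : X ⟶ Y) :
    WeakEquivalence f ↔ WeakEquivalence (U.map f) := by
  rw [HomotopicalAlgebra.weakEquivalence_iff, HomotopicalAlgebra.weakEquivalence_iff, hM.1]
  rfl

lemma IsTransferred.fibration_iff {X Y : D} (f : X ⟶ Y) :
    Fibration f ↔ Fibration (U.map f) := by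
  rw [HomotopicalAlgebra.fibration_iff, HomotopicalAlgebra.fibration_iff, hM.2]
  rfl

lemma IsTransferred.trivialFibrations_eq :
    trivialFibrations D = (trivialFibrations C).inverseImage U := by
  unfold trivialFibrations
  rw [hM.1, hM.2]
  rfl

lemma IsTransferred.isQuillenAdjunction {F : C ⥤ D} (adj : F ⊣ U) : IsQuillenAdjunction adj where
  map_cofibration A B i hi := by
    rw [cofibration_iff, ← trivialFibrations_llp]
    intro X Y p hp
    rw [adj.hasLiftingProperty_iff]
    rw [hM.trivialFibrations_eq] at hp
    rw [cofibration_iff, ← trivialFibrations_llp] at hi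
    exact hi _ hp
  map_trivialCofibration A B i hi hi' := by
    have h : (fibrations D).llp (F.map i) := by
      intro X Y p hp
      rw [adj.hasLiftingProperty_iff]
      rw [hM.2] at hp
      have : (fibrations C).llp i := by
        rw [fibrations_llp]
        exact mem_trivialCofibrations i
      exact this _ hp
    rw [fibrations_llp] at h
    exact ⟨h.2⟩

lemma IsTransferred.isCombinatorial [IsLocallyPresentable.{w} D] {F : C ⥤ D} (adj : F ⊣ U)
    {I J : MorphismProperty C} (hIJ : IsCofibrantlyGenerated I J) :
    IsCombinatorial (I.strictMap F) (J.strictMap F) := by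
  have := hIJ.isSmall_I
  have := hIJ.isSmall_J
  have := isSmall_strictMap I F
  have := isSmall_strictMap J F
  exact
    { smallObjectArgument_I := hasSmallObjectArgument_of_isSmall _
      smallObjectArgument_J := hasSmallObjectArgument_of_isSmall _
      fibrations_eq := by rw [rlp_strictMap J adj, ← hIJ.fibrations_eq, hM.2]
      trivialFibrations_eq := by
        rw [rlp_strictMap I adj, ← hIJ.trivialFibrations_eq, hM.trivialFibrations_eq]
      locallyPresentable := inferInstance }

lemma IsTransferred.isLeftProper (hC : IsLeftProper C)
    (hcof : cofibrations D ≤ homotopyFlatMorphisms U) : IsLeftProper D := by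
  intro A B A' B' f i i' f' sq hi hf
  rw [hM.weakEquivalence_iff] at hf ⊢
  exact (isHomotopyPushout_iff_of_weakEquivalence_left hC (sq.flip.toCommSq.map U) hf).1
    (hcof _ hi.mem _ _ _ sq.flip)

lemma IsTransferred.createsHomotopyPushouts (hC : IsLeftProper C)
    (hcof : cofibrations D ≤ homotopyFlatMorphisms U) : CreatesHomotopyPushouts U := by
  intro A B X Y f g h k sq
  -- The square splits into the pushout along `i`, whose image is a homotopy pushout, and a square
  -- with top edge `p`, whose image is one exactly when `U q` is a weak equivalence.
  have key : ∀ {B' P : D} {i : A ⟶ B'} {p : B' ⟶ B} {inl : B' ⟶ P} {inr : X ⟶ P} {q : P ⟶ Y},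
      Cofibration i → WeakEquivalence p → i ≫ p = f → IsPushout i g inl inr →
      inl ≫ q = p ≫ h → inr ≫ q = k →
      (IsHomotopyPushout (U.map f) (U.map g) (U.map h) (U.map k) ↔ WeakEquivalence q) := by
    intro B' P i p inl inr q hi hp fac hP hq₁ hq₂
    have sq' : CommSq (U.map p) (U.map inl) (U.map h) (U.map q) :=
      ⟨by rw [← U.map_comp, ← U.map_comp, hq₁]⟩
    have h₁ := hcof _ hi.mem _ _ _ hP
    rw [hM.weakEquivalence_iff] at hp ⊢
    rw [← fac, ← hq₂, U.map_comp, U.map_comp, h₁.paste_horiz_iff hC sq',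
      isHomotopyPushout_iff_of_weakEquivalence_top hC sq' hp]
  constructor
  · rintro ⟨-, B', P, i, p, inl, inr, q, hi, hp, fac, hP, hq₁, hq₂, hq⟩
    exact (key hi hp fac hP hq₁ hq₂).2 hq
  · intro hUsq
    obtain ⟨B', i, p, hi, -, hp, fac⟩ := exists_cofibration_fac f
    have hP := IsPushout.of_hasPushout i g
    let q : pushout i g ⟶ Y := hP.desc (p ≫ h) k (by rw [reassoc_of% fac, sq.w])
    exact ⟨sq, B', _, i, p, _, _, q, hi, hp, fac, hP, hP.inl_desc _ _ _, hP.inr_desc _ _ _,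
      (key hi hp fac hP (hP.inl_desc _ _ _) (hP.inr_desc _ _ _)).1 hUsq⟩

lemma IsTransferred.isRightProper [PreservesLimitsOfShape WalkingCospan U]
    (hC : IsRightProper C) : IsRightProper D := by
  intro A B A' B' f' p' p f sq hp hf
  rw [hM.weakEquivalence_iff] at hf ⊢
  rw [hM.fibration_iff] at hp
  exact hC _ _ _ _ (sq.map U) hp hf

lemma IsTransferred.createsHomotopyPullbacks [PreservesLimitsOfShape WalkingCospan U]
    (hC : IsRightProper C) : CreatesHomotopyPullbacks U := by
  intro A B X Y f g h k sq
  have key : ∀ {B' P : D} {j : B ⟶ B'} {p : B' ⟶ Y} {fst : P ⟶ B'} {snd : P ⟶ X} {q : A ⟶ P},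
      WeakEquivalence j → Fibration p → j ≫ p = h → IsPullback fst snd p k →
      q ≫ fst = f ≫ j → q ≫ snd = g →
      (IsHomotopyPullback (U.map f) (U.map g) (U.map h) (U.map k) ↔ WeakEquivalence q) := by
    intro B' P j p fst snd q hj hp fac hP hq₁ hq₂
    rw [hM.weakEquivalence_iff] at hj ⊢
    rw [hM.fibration_iff] at hp
    exact isHomotopyPullback_iff_of_fibration hC (sq.map U) hj hp
      (by rw [← U.map_comp, fac]) (hP.map U) (by rw [← U.map_comp, hq₁, U.map_comp])
      (by rw [← U.map_comp, hq₂])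
  constructor
  · rintro ⟨-, B', P, j, p, fst, snd, q, hj, hp, fac, hP, hq₁, hq₂, hq⟩
    exact (key hj hp fac hP hq₁ hq₂).2 hq
  · intro hUsq
    obtain ⟨B', j, p, -, hj, hp, fac⟩ := exists_trivialCofibration_fac h
    have hP := IsPullback.of_hasPullback p k
    let q : A ⟶ pullback p k := hP.lift (f ≫ j) g (by rw [Category.assoc, fac, sq.w])
    exact ⟨sq, B', _, j, p, _, _, q, hj, hp, fac, hP, hP.lift_fst _ _ _, hP.lift_snd _ _ _,
      (key hj hp fac hP (hP.lift_fst _ _ _) (hP.lift_snd _ _ _)).1 hUsq⟩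

end

end ModelStructure

/-! ### The unit on cofibrant objects -/

section Unit

variable {C : Type u} [Category.{w} C] [ModelCategory C] {D : Type u'} [Category.{w} D]
  {F : C ⥤ D} {U : D ⥤ C} (adj : F ⊣ U)

/-- The morphisms in `C` along which cobase changes preserve the objects on which the unit of
the adjunction is a weak equivalence. -/
def unitPreservingMorphisms : MorphismProperty C := fun X Y f ↦
  ∀ ⦃Z W : C⦄ (g : X ⟶ Z) (h : Y ⟶ W) (k : Z ⟶ W), IsPushout f g h k →
    WeakEquivalence (adj.unit.app Z) → WeakEquivalence (adj.unit.app W)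

lemma weakEquivalence_unit_of_iso {X Y : C} (f : X ⟶ Y) [IsIso f]
    (hX : WeakEquivalence (adj.unit.app X)) : WeakEquivalence (adj.unit.app Y) :=
  weakEquivalence_of_precomp_of_fac (f := f) (adj.unit.naturality f)

instance : (unitPreservingMorphisms adj).IsStableUnderCobaseChange where
  of_isPushout sq hf := fun _ _ _ _ _ sq' ↦ hf _ _ _ (sq.flip.paste_vert sq')

instance : (unitPreservingMorphisms adj).IsMultiplicative where
  id_mem X Z W g h k sq hZ := by
    have : IsIso k := sq.isIso_inr_of_isIso
    exact weakEquivalence_unit_of_iso adj k hZ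
  comp_mem f f' hf hf' Z W g h k sq hZ := by
    have sq₁ := IsPushout.of_hasPushout f g
    exact hf' _ _ _ (sq.of_left' sq₁) (hf _ _ _ sq₁ hZ)

/-- The unit at the colimit is the filtered colimit of the units followed by the comparison map of
`hcolim`. -/
lemma weakEquivalence_unit_of_isColimit [HasColimitsOfSize.{w, w} C]
    (hfilt : FilteredColimitsHomotopical C)
    (hcolim : PreservesFilteredColimitsUpToWeakEquivalence U)
    {P : Type w} [PartialOrder P] [IsFiltered P] {X : P ⥤ C}
    (hX : ∀ j, WeakEquivalence (adj.unit.app (X.obj j))) {c : Cocone X} (hc : IsColimit c) :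
    WeakEquivalence (adj.unit.app c.pt) := by
  have := adj.leftAdjoint_preservesColimits
  have h₁ := hcolim P (X ⋙ F) (F.mapCocone c) (isColimitOfPreserves F hc)
  let t : X ⟶ (X ⋙ F) ⋙ U := Functor.whiskerLeft X adj.unit
  let φ : c.pt ⟶ colimit ((X ⋙ F) ⋙ U) := hc.desc ⟨_, t ≫ (colimit.cocone _).ι⟩
  have hφ : ∀ j, c.ι.app j ≫ φ = t.app j ≫ colimit.ι ((X ⋙ F) ⋙ U) j := fun j ↦ hc.fac _ j
  have h₂ : WeakEquivalence φ :=
    weakEquivalence_of_isColimit hfilt hc (colimit.isColimit _) t hX φ hφ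
  have : φ ≫ colimit.desc ((X ⋙ F) ⋙ U) (U.mapCocone (F.mapCocone c)) = adj.unit.app c.pt := by
    refine hc.hom_ext (fun j ↦ ?_)
    rw [reassoc_of% (hφ j), colimit.ι_desc]
    exact (adj.unit.naturality (c.ι.app j)).symm
  rw [← this]
  infer_instance

attribute [local instance] IsFiltered.isConnected in
lemma isStableUnderColimitsOfShape_unitPreservingMorphisms [HasColimitsOfSize.{w, w} C]
    (hfilt : FilteredColimitsHomotopical C)
    (hcolim : PreservesFilteredColimitsUpToWeakEquivalence U)
    (P : Type w) [PartialOrder P] [IsFiltered P] :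
    (unitPreservingMorphisms adj).IsStableUnderColimitsOfShape P where
  condition X₁ X₂ c₁ c₂ h₁ h₂ f hf φ hφ Z W g h k sq hZ := by
    let g' : X₁ ⟶ (Functor.const P).obj Z := c₁.ι ≫ (Functor.const P).map g
    have sqK := IsPushout.of_hasPushout f g'
    obtain ⟨α, ⟨hα⟩, -, -⟩ := exists_isColimit_of_isPushout sqK h₁ h₂
      (isColimitConstCocone P Z) hφ (ψ := g) (fun k ↦ (Category.comp_id _).symm) sq
    exact weakEquivalence_unit_of_isColimit adj hfilt hcolim
      (fun j ↦ hf j _ _ _ (sqK.map ((evaluation P C).obj j)) hZ) hα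

/-- The unit maps the pushout square to its image under `F ⋙ U`. Both are homotopy pushouts, so
three weak equivalences force the fourth. -/
lemma unitPreservingMorphisms_of_cofibration (hC : IsLeftProper C) {A B : C} (i : A ⟶ B)
    (hi : Cofibration i) (hFi : homotopyFlatMorphisms U (F.map i))
    (hA : WeakEquivalence (adj.unit.app A)) (hB : WeakEquivalence (adj.unit.app B)) :
    unitPreservingMorphisms adj i := by
  intro Z W g h k sq hZ
  have := adj.leftAdjoint_preservesColimits
  exact (isHomotopyPushout_of_isPushout hC sq
    (flatMorphisms_of_cofibration hC i hi)).weakEquivalence hC (hFi _ _ _ (sq.map F))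
    (adj.unit.naturality _) (adj.unit.naturality _) (adj.unit.naturality _)
    (adj.unit.naturality _) hA hB hZ

/-- The unit of the adjunction is a weak equivalence on cofibrant objects. -/
lemma weakEquivalence_unit_of_isCofibrant [HasColimitsOfSize.{w, w} C]
    {I J : MorphismProperty C} (hIJ : IsCofibrantlyGenerated I J) (hC : IsLeftProper C)
    (hfilt : FilteredColimitsHomotopical C)
    (hcolim : PreservesFilteredColimitsUpToWeakEquivalence U)
    (hpush : I.strictMap F ≤ homotopyFlatMorphisms U) (hunit : UnitCondition adj I J)
    (X : C) [hX : IsCofibrant X] : WeakEquivalence (adj.unit.app X) := by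
  have := hIJ.smallObjectArgument_I
  have hI : I ≤ unitPreservingMorphisms adj := fun A B i hi ↦ by
    have hi' : Cofibration i := by
      rw [cofibration_iff, hIJ.cofibrations_eq]
      exact MorphismProperty.le_llp_rlp _ _ hi
    exact unitPreservingMorphisms_of_cofibration adj hC i hi' (hpush _ ⟨hi⟩)
      (hunit.unit_generators i hi).1 (hunit.unit_generators i hi).2
  have h₀ : I.rlp.llp (initial.to X) := by
    rw [← hIJ.cofibrations_eq]
    exact hX.mem
  rw [MorphismProperty.llp_rlp_of_hasSmallObjectArgument] at h₀
  obtain ⟨A, B, f, r, hf⟩ := h₀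
  have hB' := transfiniteCompositions_pushouts_coproducts_le (unitPreservingMorphisms adj)
    (isStableUnderColimitsOfShape_unitPreservingMorphisms adj hfilt hcolim) hI f hf
  -- The cell complex `f` starts at some `A` that merely retracts onto the initial object. Pushing
  -- it out along `A ⟶ ⊥_ C` gives a cell complex on the initial object, with `X` as a retract.
  have sq := IsPushout.of_hasPushout f r.left.r
  have hW := hB' _ _ _ sq hunit.unit_initial
  let e : Retract X (pushout f r.left.r) :=
    { i := r.right.i ≫ pushout.inl _ _
      r := sq.desc r.right.r (initial.to X) (by simp)
      retract := by simp }
  let e' : RetractArrow (adj.unit.app X) (adj.unit.app (pushout f r.left.r)) :=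
    { i := Arrow.homMk e.i (U.map (F.map e.i)) (adj.unit.naturality e.i)
      r := Arrow.homMk e.r (U.map (F.map e.r)) (adj.unit.naturality e.r)
      retract := by
        ext
        · exact e.retract
        · exact (e.map (F ⋙ U)).retract }
  exact ⟨MorphismProperty.of_retract e' hW.mem⟩

end Unit

/-! ### The Quillen equivalence and the main theorem -/

variable {C : Type u} [Category.{w} C] [ModelCategory C] [HasColimitsOfSize.{w, w} C]
  {D : Type u'} [Category.{w} D] {F : C ⥤ D} {U : D ⥤ C} (adj : F ⊣ U) {I J : MorphismProperty C}

lemma weakEquivalence_map_map_of_unitCondition (hIJ : IsCofibrantlyGenerated I J)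
    (hC : IsLeftProper C) (hfilt : FilteredColimitsHomotopical C)
    (hcolim : PreservesFilteredColimitsUpToWeakEquivalence U)
    (hpush : I.strictMap F ≤ homotopyFlatMorphisms U) (hunit : UnitCondition adj I J)
    {A B : C} (j : A ⟶ B) (hj : J j) : WeakEquivalence (U.map (F.map j)) := by
  obtain ⟨hA, hB⟩ := hunit.cofibrant j hj
  have := weakEquivalence_unit_of_isCofibrant adj hIJ hC hfilt hcolim hpush hunit A
  have := weakEquivalence_unit_of_isCofibrant adj hIJ hC hfilt hcolim hpush hunit B
  have hj' : trivialCofibrations C j := by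
    rw [hIJ.trivialCofibrations_eq]
    exact MorphismProperty.le_llp_rlp _ _ hj
  have : WeakEquivalence j := ⟨hj'.2⟩
  have h : WeakEquivalence (adj.unit.app A ≫ U.map (F.map j)) := by
    have := adj.unit.naturality j
    dsimp at this
    rw [← this]
    infer_instance
  exact weakEquivalence_of_precomp (adj.unit.app A) _

lemma IsTransferred.isQuillenEquivalence {M : ModelCategory D} (hM : IsTransferred U M)
    (hIJ : IsCofibrantlyGenerated I J)
    (hC : IsLeftProper C) (hfilt : FilteredColimitsHomotopical C)
    (hcolim : PreservesFilteredColimitsUpToWeakEquivalence U)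
    (hpush : I.strictMap F ≤ homotopyFlatMorphisms U) (hunit : UnitCondition adj I J) :
    IsQuillenEquivalence adj where
  toIsQuillenAdjunction := hM.isQuillenAdjunction adj
  weakEquivalence_iff X Y _ _ f := by
    have := weakEquivalence_unit_of_isCofibrant adj hIJ hC hfilt hcolim hpush hunit X
    rw [adj.homEquiv_unit, hM.weakEquivalence_iff]
    exact (weakEquivalence_precomp_iff (adj.unit.app X) (U.map f)).symm

end TransferCriterion

theorem mainTheorem8
    {C : Type u} [Category.{w} C] [ModelCategory C]
    [HasLimitsOfSize.{w, w} C] [HasColimitsOfSize.{w, w} C]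
    {D : Type u'} [Category.{w} D] [IsLocallyPresentable.{w} D]
    {F : C ⥤ D} {U : D ⥤ C} (adj : F ⊣ U)
    (I J : MorphismProperty C)
    (hIJ : IsCofibrantlyGenerated I J)
    (hproper : IsLeftProper C)
    (hfilt : FilteredColimitsHomotopical C)
    (hpush : ∀ ⦃A B : C⦄ (i : A ⟶ B), I i →
      ∀ ⦃X Y : D⦄ (g : F.obj A ⟶ X) (h : F.obj B ⟶ Y) (k : X ⟶ Y),
        IsPushout (F.map i) g h k →
          IsHomotopyPushout (U.map (F.map i)) (U.map g) (U.map h) (U.map k))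
    (hcolim : PreservesFilteredColimitsUpToWeakEquivalence U) :
    ((∀ ⦃A B : C⦄ (j : A ⟶ B), J j → WeakEquivalence (U.map (F.map j))) →
      (∃! M : ModelCategory D, IsTransferred U M) ∧
      ∀ M : ModelCategory D, IsTransferred U M →
        IsCombinatorial (I.strictMap F) (J.strictMap F) ∧
        IsLeftProper D ∧
        CreatesHomotopyPushouts U ∧
        FilteredColimitsHomotopical D ∧
        (IsRightProper C → IsRightProper D ∧ CreatesHomotopyPullbacks U)) ∧
    (UnitCondition adj I J →
      (∀ ⦃A B : C⦄ (j : A ⟶ B), J j → WeakEquivalence (U.map (F.map j))) ∧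
      ∀ M : ModelCategory D, IsTransferred U M → IsQuillenEquivalence adj) := by
  have hpush' : I.strictMap F ≤ homotopyFlatMorphisms U := by
    rintro _ _ _ ⟨hi⟩
    exact fun _ _ g h k sq ↦ hpush _ hi g h k sq
  refine ⟨fun hJ ↦ ?_, fun hunit ↦ ⟨fun A B j hj ↦ ?_, fun M hM ↦ ?_⟩⟩
  · have hJ' : J.strictMap F ≤ (weakEquivalences C).inverseImage U := by
      rintro _ _ _ ⟨hj⟩
      exact (hJ _ hj).mem
    obtain ⟨M₀, hM₀⟩ := exists_isTransferred adj hIJ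
      (llp_rlp_strictMap_le_weakEquivalences adj hIJ hproper hfilt hcolim hpush' hJ')
    refine ⟨⟨M₀, hM₀, fun M hM ↦ hM.eq hM₀⟩, fun M hM ↦ ?_⟩
    have hcomb := hM.isCombinatorial adj hIJ
    have hcof : cofibrations D ≤ homotopyFlatMorphisms U := by
      rw [hcomb.toIsCofibrantlyGenerated.cofibrations_eq]
      exact llp_rlp_strictMap_le_homotopyFlatMorphisms hIJ hproper hfilt hcolim hpush'
    refine ⟨hcomb, hM.isLeftProper hproper hcof, hM.createsHomotopyPushouts hproper hcof, ?_,
      fun hright ↦ ?_⟩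
    · unfold FilteredColimitsHomotopical
      rw [hM.1]
      exact isStableUnderFilteredColimits_inverseImage_weakEquivalences U hfilt hcolim
    · have := adj.rightAdjoint_preservesLimits
      exact ⟨hM.isRightProper hright, hM.createsHomotopyPullbacks hright⟩
  · exact weakEquivalence_map_map_of_unitCondition adj hIJ hproper hfilt hcolim hpush' hunit j hj
  · exact hM.isQuillenEquivalence adj hIJ hproper hfilt hcolim hpush' hunit
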